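/- Let $K_B$ and $K_C$ be two circles in $\mathbb R^2$ with a common center and different radii. Let $A_1B_1A_2B_2$ be a convex quadrilateral (three consecutive vertices are allowed to be collinear) whose four sides touch $K_C$, and let $A_1C_1A_2C_2$ be a self-intersecting quadrilateral (two opposite sides cross at an interior point of both) such that each of the four straight lines containing its sides is tangent to $K_B$. The octahedron $\mathscr O$ with vertices $A_1,A_2,B_1,B_2,C_1,C_2$ and the eight triangular faces $A_iB_jC_k$, $i,j,k\in\{1,2\}$, is a Bricard octahedron of type 3 in a flat position; its twelve edges are the segments $A_iB_j$, $B_jC_k$, $C_kA_i$. Let $\mathscr O(t)$, $t\in I$, where $I\subset\mathbb R$ is an interval, be any flex of $\mathscr O$, i.e. a family of octahedra in $\mathbb R^3$ whose vertices depend continuously on $t$ and each of whose faces is, for every $t\in I$, congruent to the corresponding face of $\mathscr O$. Fix an orientation of the octahedron, i.e. a coherent choice of unit normals to the faces. For an edge $\ell$ with adjacent faces $Q_1,Q_2$, the dihedral angle at $\ell$ is the angle, defined modulo $2\pi$, by which $Q_1$ has to be rotated about $\ell$ in the direction of its normal so as to lie on the same side of $\ell$, in the same half-plane, as $Q_2$;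 for each edge let $\alpha_\ell(t)$, $t\in I$, be any continuous single-valued branch of it. Then for every $\mathbb Q$-linear function $f:\mathbb R\to\mathbb R$ with $f(\pi)=0$ the Dehn invariant $$D_f\,\mathscr O(t)=\sum_{\ell}|\ell|\,f\bigl(\alpha_\ell(t)\bigr),$$ where the sum is over the twelve edges and $|\ell|$ is the length of $\ell$, is constant in $t\in I$; moreover, it equals zero for every $t\in I$. -/

import Mathlib

open scoped Affine

noncomputable section

namespace Bricard

/-- The Euclidean plane. -/
abbrev E2 := EuclideanSpace ℝ (Fin 2)

/-- Euclidean three-space. -/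
abbrev E3 := EuclideanSpace ℝ (Fin 3)

/-- A labelled octahedron, given by its six vertices. The first index says which pair of opposite
vertices is meant (`0` for `A₁, A₂`, `1` for `B₁, B₂`, `2` for `C₁, C₂`), the second one which
vertex of the pair. -/
abbrev Octahedron (V : Type*) := Fin 3 → Fin 2 → V

/-- The three vertices `A_i, B_j, C_k` of the face with `s = (i, j, k)`. -/
def face {V : Type*} (P : Octahedron V) (s : Fin 3 → Fin 2) : Fin 3 → V := fun m => P m (s m)

/-! ### Plane quadrilaterals -/

/-- `abcd` is a convex quadrilateral (three consecutive vertices may be collinear): the vertices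
are distinct, not all on one line, and for each side the two other vertices lie in a common closed
half-plane bounded by the line through that side. -/
structure IsConvexQuadrilateral (a b c d : E2) : Prop where
  distinct : Function.Injective ![a, b, c, d]
  not_collinear : ¬ Collinear ℝ {a, b, c, d}
  side_ab : line[ℝ, a, b].WSameSide c d
  side_bc : line[ℝ, b, c].WSameSide d a
  side_cd : line[ℝ, c, d].WSameSide a b
  side_da : line[ℝ, d, a].WSameSide b c

/-- `abcd` is a quadrilateral with self-intersections: the vertices are distinct, not all on one
line, and two opposite sides cross at a relatively interior point of both. -/
structure IsCrossedQuadrilateral (a b c d : E2) : Prop where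
  distinct : Function.Injective ![a, b, c, d]
  not_collinear : ¬ Collinear ℝ {a, b, c, d}
  cross : (openSegment ℝ a b ∩ openSegment ℝ c d).Nonempty ∨
    (openSegment ℝ b c ∩ openSegment ℝ d a).Nonempty

/-- `O` is a Bricard octahedron of type 3 in a flat position: there are two different circles `K_B`,
`K_C` with a common center such that `A₁B₁A₂B₂` is a convex quadrilateral whose sides (as segments)
touch `K_C`, and `A₁C₁A₂C₂` is a quadrilateral with self-intersections such that the straight lines
containing its sides are tangent to `K_B`. -/
def IsFlatType3 (O : Octahedron E2) : Prop :=
  ∃ (o : E2) (rB rC : ℝ), 0 < rB ∧ 0 < rC ∧ rB ≠ rC ∧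
    IsConvexQuadrilateral (O 0 0) (O 1 0) (O 0 1) (O 1 1) ∧
    (∀ i j, ∃ x ∈ segment ℝ (O 0 i) (O 1 j),
      (EuclideanGeometry.Sphere.mk o rC).IsTangentAt x line[ℝ, O 0 i, O 1 j]) ∧
    IsCrossedQuadrilateral (O 0 0) (O 2 0) (O 0 1) (O 2 1) ∧
    (∀ i j, (EuclideanGeometry.Sphere.mk o rB).IsTangent line[ℝ, O 0 i, O 2 j])

/-! ### Flexes -/

/-- `P` is a flex, over the set `I` of parameters, of the octahedron with flat position `O`: the
vertices move continuously in space and every face stays congruent to the corresponding face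
of `O`. -/
structure IsFlex (O : Octahedron E2) (I : Set ℝ) (P : ℝ → Octahedron E3) : Prop where
  continuousOn : ContinuousOn P I
  congruent : ∀ t ∈ I, ∀ s, Congruent (face (P t) s) (face O s)

/-! ### Dihedral angles and Dehn invariants -/

/-- The cross product in `E3`. -/
def cross (u v : E3) : E3 := WithLp.toLp 2 (crossProduct u.ofLp v.ofLp)

/-- The unit normal vector to the face `A_i B_j C_k`, `s = (i, j, k)`. Adjacent faces differ in
exactly one index, so the sign makes the normals of all eight faces set an orientation of the
octahedron; `ω = ± 1` chooses one of the two orientations. -/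
def faceNormal (ω : ℤˣ) (P : Octahedron E3) (s : Fin 3 → Fin 2) : E3 :=
  (((ω : ℤ) : ℝ) * (-1) ^ ((s 0 : ℕ) + (s 1 : ℕ) + (s 2 : ℕ))) •
    NormedSpace.normalize (cross (P 1 (s 1) - P 0 (s 0)) (P 2 (s 2) - P 0 (s 0)))

/-- The unit vector orthogonal to the line `pq` pointing from it towards `x`. -/
def unitPerp (p q x : E3) : E3 :=
  NormedSpace.normalize ((x - p) - (inner ℝ (q - p) (x - p) / ‖q - p‖ ^ 2) • (q - p))

/-- The edges are indexed by triples `(k, i, j)`: the edge joins the vertices `P (k+1) i` and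
`P (k+2) j` (indices modulo 3). This is the face that contains it and the vertex `P k c`; the two
faces adjacent to the edge are obtained for `c = 0` and `c = 1`. -/
def adjFace (k : Fin 3) (i j c : Fin 2) : Fin 3 → Fin 2 :=
  fun m => if m = k then c else if m = k + 1 then i else j

/-- `α` is one of the values of the (multi-valued) dihedral angle of the oriented octahedron at the
edge `(k, i, j)`: rotating the first adjacent face about the edge by the angle `α`, in the direction
of its normal vector, brings it to the side of the edge where the second adjacent face lies.
These values form a coset of `2πℤ`. -/
def IsDihedralAngle (ω : ℤˣ) (P : Octahedron E3) (k : Fin 3) (i j : Fin 2) (α : ℝ) : Prop :=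
  unitPerp (P (k + 1) i) (P (k + 2) j) (P k 1) =
    Real.cos α • unitPerp (P (k + 1) i) (P (k + 2) j) (P k 0) +
      Real.sin α • faceNormal ω P (adjFace k i j 0)

/-- The Dehn invariant `∑ |ℓ| f(α_ℓ)`, the sum being over the twelve edges, computed from the
values `α` of the dihedral angles. -/
def dehnInvariant (f : ℝ →ₗ[ℚ] ℝ) (P : Octahedron E3) (α : Fin 3 → Fin 2 → Fin 2 → ℝ) : ℝ :=
  ∑ k, ∑ i, ∑ j, dist (P (k + 1) i) (P (k + 2) j) * f (α k i j)

end Bricard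

end

/-!
The Dehn invariant vanishes for every single realization of the octahedron in space, each taken by
itself; constancy along a motion is a consequence.

*Planar position.* Take the common center of the circles as the origin of the complex plane. If the
sides of a quadrilateral `a₀ b₀ a₁ b₁` lie on tangents of a circle around `0`, then Vieta's formulas
for the four points of contact give `b₀ + b₁ = m (a₀ + a₁)` and `b₀ b₁ = m a₀ a₁` with a real `m`
(`exists_ratio`). This relation between two pairs of opposite vertices is transitive, and it implies
`(b₀ - a) (b₁ - a) = (1 - m) a²` for each vertex `a` of the first pair (`IsIsogonal.mirror`). Hence
the edges from any vertex to any pair of opposite vertices lie on two lines that are mirror images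
of each other in the line joining the vertex to the center; in particular the lines `b_i c_j` also
touch a circle around the center, with a positive radius because `a₀ c₀ a₁ c₁` crosses itself.

*Vertices.* Up to antipodes, the link of every vertex is therefore a spherical quadrilateral with
equal opposite sides. It is symmetric in a plane or in an axis (`spherical_isogram`), so opposite
dihedral angles agree up to sign and multiples of `π`, with signs depending on the symmetry, and
the tangents of the half folding angles of adjacent edges are in the ratio of the radii of the two
circles (first mode) or of the lengths of the two tangents from the vertex (second mode); see
`link_dichotomy`. Thus the additive function takes, up to sign, one value on each of the three
classes of four edges.

*Lengths.* An edge is divided by its point of contact into two pieces, and the pieces at a vertex on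
two opposite edges have the same length. If all vertices fold in the first mode, the signs are such
that these pieces cancel (`IsConcentric.sum_mul_eq_zero`). As the three radii are different, the
second mode can only occur simultaneously at both vertices of two pairs, each of them at equal
distances from the center, unless all edges are flat (`sum_eq_zero_of_modes`). By convexity and
crossing these are the pairs `a` and `c`; then the planar position is symmetric in a line containing
`b₀` and `b₁` (`IsPlanarPosition.exists_isConcentric`), and edges that are mirror images cancel.
-/

open scoped ComplexConjugate

namespace Bricard

/-! ### Vector algebra in space -/

theorem inner_E3 (u v : E3) : inner ℝ u v = u 0 * v 0 + u 1 * v 1 + u 2 * v 2 := by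
  simp [PiLp.inner_apply, Fin.sum_univ_three, mul_comm]

theorem cross_zero (u v : E3) : cross u v 0 = u 1 * v 2 - u 2 * v 1 := by
  simp [cross, cross_apply]

theorem cross_one (u v : E3) : cross u v 1 = u 2 * v 0 - u 0 * v 2 := by
  simp [cross, cross_apply]

theorem cross_two (u v : E3) : cross u v 2 = u 0 * v 1 - u 1 * v 0 := by
  simp [cross, cross_apply]

theorem ext_E3 {u v : E3} (h0 : u 0 = v 0) (h1 : u 1 = v 1) (h2 : u 2 = v 2) : u = v := by
  ext i; fin_cases i <;> assumption

theorem inner_cross_cross (a b c d : E3) :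
    inner ℝ (cross a b) (cross c d) =
      inner ℝ a c * inner ℝ b d - inner ℝ a d * inner ℝ b c := by
  simp only [inner_E3, cross_zero, cross_one, cross_two]; ring

theorem norm_cross_sq (a b : E3) :
    ‖cross a b‖ ^ 2 = ‖a‖ ^ 2 * ‖b‖ ^ 2 - inner ℝ a b ^ 2 := by
  rw [← real_inner_self_eq_norm_sq, ← real_inner_self_eq_norm_sq, ← real_inner_self_eq_norm_sq,
    inner_cross_cross, real_inner_comm b a]; ring

theorem cross_smul_smul (r s : ℝ) (a b : E3) : cross (r • a) (s • b) = (r * s) • cross a b := by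
  apply ext_E3 <;> simp [cross_zero, cross_one, cross_two] <;> ring

theorem inner_cross_self_left (a b : E3) : inner ℝ (cross a b) a = 0 := by
  simp only [inner_E3, cross_zero, cross_one, cross_two]; ring

/-- The triple product is alternating: this is the form in which linear dependence of
`a₀ - a₁` and `b₀ - b₁` is used. -/
theorem inner_cross_sub (a₀ a₁ b₀ b₁ : E3) :
    inner ℝ (cross a₀ b₀) b₁ - inner ℝ (cross a₁ b₀) b₁ =
      inner ℝ (cross (a₀ - a₁) (b₀ - b₁)) b₁ := by
  simp only [inner_E3, cross_zero, cross_one, cross_two, PiLp.sub_apply]; ring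

theorem inner_cross_add (a₀ a₁ b₀ b₁ : E3) :
    inner ℝ (cross a₀ b₀) b₁ + inner ℝ (cross a₁ b₀) b₁ =
      inner ℝ (cross (a₀ + a₁) (b₀ + b₁)) b₁ := by
  simp only [inner_E3, cross_zero, cross_one, cross_two, PiLp.add_apply]; ring

theorem cross_neg_swap (a b : E3) : cross a b = - cross b a := by
  apply ext_E3 <;> simp [cross_zero, cross_one, cross_two, mul_comm]

/-- Two planes through the origin of three-space cannot be orthogonal to each other. -/
theorem cross_eq_zero_or_of_orthogonal {a b c d : E3} (hac : inner ℝ a c = 0)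
    (had : inner ℝ a d = 0) (hbc : inner ℝ b c = 0) (hbd : inner ℝ b d = 0) :
    cross a b = 0 ∨ cross c d = 0 := by
  by_cases hN : cross a b = 0
  · exact Or.inl hN
  right
  -- a vector orthogonal to both `a` and `b` is a multiple of `cross a b`
  have key : ∀ e : E3, inner ℝ a e = 0 → inner ℝ b e = 0 →
      ‖cross a b‖ ^ 2 • e = inner ℝ (cross a b) e • cross a b := by
    intro e ha hb
    rw [← real_inner_self_eq_norm_sq]
    simp only [inner_E3] at ha hb
    apply ext_E3 <;> simp only [inner_E3, cross_zero, cross_one, cross_two, PiLp.smul_apply,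
      smul_eq_mul]
    · linear_combination (-b 2 * (a 2 * b 0 - a 0 * b 2) + b 1 * (a 0 * b 1 - a 1 * b 0)) * ha - (- a 2 * (a 2 * b 0 - a 0 * b 2) + a 1 * (a 0 * b 1 - a 1 * b 0)) * hb
    · linear_combination (- b 0 * (a 0 * b 1 - a 1 * b 0) + b 2 * (a 1 * b 2 - a 2 * b 1)) * ha - (- a 0 * (a 0 * b 1 - a 1 * b 0) + a 2 * (a 1 * b 2 - a 2 * b 1)) * hb
    · linear_combination (- b 1 * (a 1 * b 2 - a 2 * b 1) + b 0 * (a 2 * b 0 - a 0 * b 2)) * ha - (- a 1 * (a 1 * b 2 - a 2 * b 1) + a 0 * (a 2 * b 0 - a 0 * b 2)) * hb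
  have hpos : ‖cross a b‖ ^ 2 ≠ 0 := pow_ne_zero _ (norm_ne_zero_iff.2 hN)
  have h : (‖cross a b‖ ^ 2 * ‖cross a b‖ ^ 2) • cross c d = 0 := by
    rw [← cross_smul_smul, key c hac hbc, key d had hbd, cross_smul_smul]
    have : cross (cross a b) (cross a b) = 0 := by
      apply ext_E3 <;> simp [cross_zero, cross_one, cross_two] <;> ring
    rw [this, smul_zero]
  exact (smul_eq_zero.1 h).resolve_left (mul_ne_zero hpos hpos)

/-! ### Spherical quadrilaterals with equal opposite sides -/

/-- A spherical quadrilateral `p₀ q₀ p₁ q₁` with equal opposite sides, whose side lengths are the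
difference and the sum of two angles with cosines `c`, `c'` and sines `s`, `s'`, has a two-fold
symmetry: either it is symmetric in an axis (second alternative) or in a plane (first
alternative). This determines the relation between the two diagonals, and the relations between
opposite angles, which are expressed by triple products. -/
theorem spherical_isogram {p₀ p₁ q₀ q₁ : E3} {c s c' s' : ℝ}
    (hp₀ : ‖p₀‖ = 1) (hp₁ : ‖p₁‖ = 1) (hq₀ : ‖q₀‖ = 1) (hq₁ : ‖q₁‖ = 1)
    (h₀₀ : inner ℝ p₀ q₀ = c * c' + s * s') (h₁₁ : inner ℝ p₁ q₁ = c * c' + s * s')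
    (h₀₁ : inner ℝ p₀ q₁ = c * c' - s * s') (h₁₀ : inner ℝ p₁ q₀ = c * c' - s * s') :
    ((1 - inner ℝ p₀ p₁) * (1 - inner ℝ q₀ q₁) = 4 * s ^ 2 * s' ^ 2 ∧
      inner ℝ (cross p₀ q₀) q₁ = inner ℝ (cross p₁ q₀) q₁ ∧
      inner ℝ (cross q₀ p₀) p₁ = inner ℝ (cross q₁ p₀) p₁) ∨
    ((1 + inner ℝ p₀ p₁) * (1 + inner ℝ q₀ q₁) = 4 * c ^ 2 * c' ^ 2 ∧
      inner ℝ (cross p₀ q₀) q₁ = - inner ℝ (cross p₁ q₀) q₁ ∧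
      inner ℝ (cross q₀ p₀) p₁ = - inner ℝ (cross q₁ p₀) p₁) := by
  have e₀ : inner ℝ p₀ p₀ = (1 : ℝ) := by rw [real_inner_self_eq_norm_sq, hp₀, one_pow]
  have e₁ : inner ℝ p₁ p₁ = (1 : ℝ) := by rw [real_inner_self_eq_norm_sq, hp₁, one_pow]
  have f₀ : inner ℝ q₀ q₀ = (1 : ℝ) := by rw [real_inner_self_eq_norm_sq, hq₀, one_pow]
  have f₁ : inner ℝ q₁ q₁ = (1 : ℝ) := by rw [real_inner_self_eq_norm_sq, hq₁, one_pow]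
  have cp : inner ℝ p₁ p₀ = (inner ℝ p₀ p₁ : ℝ) := real_inner_comm _ _
  have cq : inner ℝ q₁ q₀ = (inner ℝ q₀ q₁ : ℝ) := real_inner_comm _ _
  have c00 : inner ℝ q₀ p₀ = c * c' + s * s' := by rw [real_inner_comm, h₀₀]
  have c11 : inner ℝ q₁ p₁ = c * c' + s * s' := by rw [real_inner_comm, h₁₁]
  have c01 : inner ℝ q₁ p₀ = c * c' - s * s' := by rw [real_inner_comm, h₀₁]
  have c10 : inner ℝ q₀ p₁ = c * c' - s * s' := by rw [real_inner_comm, h₁₀]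
  rcases cross_eq_zero_or_of_orthogonal (a := p₀ - p₁) (b := q₀ - q₁) (c := p₀ + p₁)
    (d := q₀ + q₁)
    (by simp only [inner_sub_left, inner_add_right]; linarith)
    (by simp only [inner_sub_left, inner_add_right]; linarith)
    (by simp only [inner_sub_left, inner_add_right]; linarith)
    (by simp only [inner_sub_left, inner_add_right]; linarith) with h | h
  · left
    refine ⟨?_, ?_, ?_⟩
    · have := norm_cross_sq (p₀ - p₁) (q₀ - q₁)
      rw [h, norm_zero, ← real_inner_self_eq_norm_sq, ← real_inner_self_eq_norm_sq] at this
      simp only [inner_sub_left, inner_sub_right, e₀, e₁, f₀, f₁, cp, cq, h₀₀, h₁₁, h₀₁, h₁₀]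
        at this
      linear_combination - this / 4
    · rw [← sub_eq_zero, inner_cross_sub, h, inner_zero_left]
    · rw [← sub_eq_zero, inner_cross_sub, cross_neg_swap, h, neg_zero, inner_zero_left]
  · right
    refine ⟨?_, ?_, ?_⟩
    · have := norm_cross_sq (p₀ + p₁) (q₀ + q₁)
      rw [h, norm_zero, ← real_inner_self_eq_norm_sq, ← real_inner_self_eq_norm_sq] at this
      simp only [inner_add_left, inner_add_right, e₀, e₁, f₀, f₁, cp, cq, h₀₀, h₁₁, h₀₁, h₁₀]
        at this
      linear_combination - this / 4
    · rw [← add_eq_zero_iff_eq_neg, inner_cross_add, h, inner_zero_left]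
    · rw [← add_eq_zero_iff_eq_neg, inner_cross_add, cross_neg_swap, h, neg_zero, inner_zero_left]

/-! ### Dihedral angles -/

/-- `α` is the angle from the half-plane through `y₀` to the half-plane through `y₁`, both bounded
by the line spanned by `w`, with the sense of rotation given by the sign `ε`; denominators are
cleared. -/
structure EdgeAngle (ε : ℝ) (w y₀ y₁ : E3) (α : ℝ) : Prop where
  cos_mul : Real.cos α * (‖cross w y₀‖ * ‖cross w y₁‖) = inner ℝ (cross w y₀) (cross w y₁)
  sin_mul : Real.sin α * (‖cross w y₀‖ * ‖cross w y₁‖) = ε * (‖w‖ * inner ℝ (cross w y₀) y₁)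

theorem EdgeAngle.of_unitPerp {ε : ℝ} {p q x₀ x₁ : E3} {α : ℝ}
    (h₀ : cross (q - p) (x₀ - p) ≠ 0) (h₁ : cross (q - p) (x₁ - p) ≠ 0)
    (h : unitPerp p q x₁ = Real.cos α • unitPerp p q x₀ +
      Real.sin α • ε • NormedSpace.normalize (cross (q - p) (x₀ - p))) (hε : ε * ε = 1) :
    EdgeAngle ε (q - p) (x₀ - p) (x₁ - p) α := by
  set w := q - p with hw
  have hw0 : w ≠ 0 := by
    intro h0; apply h₀; rw [h0]
    apply ext_E3 <;> simp [cross_zero, cross_one, cross_two]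
  have hwn : ‖w‖ ≠ 0 := norm_ne_zero_iff.2 hw0
  let v : E3 → E3 := fun x => (x - p) - (inner ℝ w (x - p) / ‖w‖ ^ 2) • w
  have hv : ∀ x, unitPerp p q x = ‖v x‖⁻¹ • v x := fun x => rfl
  have hin : ∀ x y, inner ℝ (v x) (v y) * ‖w‖ ^ 2 =
      inner ℝ (cross w (x - p)) (cross w (y - p)) := by
    intro x y
    simp only [v, inner_sub_left, inner_sub_right, inner_smul_left, inner_smul_right,
      inner_cross_cross, RCLike.conj_to_real, real_inner_self_eq_norm_sq]
    simp only [real_inner_comm w]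
    field_simp
    ring
  have hnorm : ∀ x, ‖v x‖ * ‖w‖ = ‖cross w (x - p)‖ := by
    intro x
    have := hin x x
    rw [real_inner_self_eq_norm_sq, real_inner_self_eq_norm_sq, ← mul_pow] at this
    exact (pow_left_inj₀ (by positivity) (by positivity) two_ne_zero).1 this
  have hcv : ∀ x y, inner ℝ (cross w (x - p)) (v y) = inner ℝ (cross w (x - p)) (y - p) := by
    intro x y
    simp only [v, inner_sub_right, inner_smul_right, inner_cross_self_left, mul_zero, sub_zero]
  have hvn : ∀ x, cross w (x - p) ≠ 0 → ‖v x‖ ≠ 0 := by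
    intro x hx h0
    apply hx
    rw [← norm_eq_zero, ← hnorm, h0, zero_mul]
  have n₀ := hvn x₀ h₀
  have n₁ := hvn x₁ h₁
  have m₀ : ‖cross w (x₀ - p)‖ ≠ 0 := norm_ne_zero_iff.2 h₀
  rw [hv, hv, NormedSpace.normalize] at h
  constructor
  · have := congrArg (fun y => inner ℝ (v x₀) y) h
    simp only [inner_smul_right, inner_add_right] at this
    rw [real_inner_comm (cross w (x₀ - p)) (v x₀), hcv, real_inner_self_eq_norm_sq] at this
    have h0 : inner ℝ (cross w (x₀ - p)) (x₀ - p) = (0 : ℝ) := by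
      simp only [inner_E3, cross_zero, cross_one, cross_two]; ring
    simp only [h0, mul_zero, add_zero, zero_add] at this
    rw [← hin, ← hnorm, ← hnorm]
    field_simp at this
    linear_combination -(‖w‖ ^ 2) * this
  · have := congrArg (fun y => inner ℝ (cross w (x₀ - p)) y) h
    simp only [inner_smul_right, inner_add_right] at this
    rw [hcv, hcv, real_inner_self_eq_norm_sq] at this
    have h0 : inner ℝ (cross w (x₀ - p)) (x₀ - p) = (0 : ℝ) := by
      simp only [inner_E3, cross_zero, cross_one, cross_two]; ring
    simp only [h0, mul_zero, add_zero, zero_add] at this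
    have e1 := hnorm x₁
    field_simp at this
    rw [← e1]
    linear_combination (-ε * ‖w‖) * this - (Real.sin α * ‖v x₁‖ * ‖w‖ * ‖cross w (x₀ - p)‖) * hε

/-- Reading an edge from its other end changes the sense of rotation in the formula. -/
theorem EdgeAngle.swap {ε : ℝ} {p q x₀ x₁ : E3} {α : ℝ}
    (h : EdgeAngle ε (q - p) (x₀ - p) (x₁ - p) α) :
    EdgeAngle (-ε) (p - q) (x₀ - q) (x₁ - q) α := by
  have hc : ∀ x, cross (p - q) (x - q) = - cross (q - p) (x - p) := by
    intro x
    apply ext_E3 <;> simp [cross_zero, cross_one, cross_two] <;> ring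
  constructor
  · rw [hc, hc, norm_neg, norm_neg, inner_neg_neg]; exact h.cos_mul
  · have e : inner ℝ (cross (q - p) (x₀ - p)) (x₁ - q) =
        (inner ℝ (cross (q - p) (x₀ - p)) (x₁ - p) : ℝ) := by
      simp only [inner_E3, cross_zero, cross_one, cross_two, PiLp.sub_apply]; ring
    rw [hc, hc, norm_neg, norm_neg, inner_neg_left, e, norm_sub_rev p q]
    linear_combination h.sin_mul

/-! ### Additive functions vanishing at `π` -/

theorem map_int_mul_pi {f : ℝ →ₗ[ℚ] ℝ} (hf : f Real.pi = 0) (n : ℤ) : f (n * Real.pi) = 0 := by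
  rw [← zsmul_eq_mul, map_zsmul, hf, smul_zero]

theorem map_eq_zero_of_sin_eq_zero {f : ℝ →ₗ[ℚ] ℝ} (hf : f Real.pi = 0) {x : ℝ}
    (h : Real.sin x = 0) : f x = 0 := by
  obtain ⟨n, rfl⟩ := Real.sin_eq_zero_iff.1 h
  exact map_int_mul_pi hf n

theorem map_eq_mul_map {f : ℝ →ₗ[ℚ] ℝ} (hf : f Real.pi = 0) {x y σ : ℝ} (hσ : σ = 1 ∨ σ = -1)
    (hc : Real.cos x = Real.cos y) (hs : Real.sin x = σ * Real.sin y) : f x = σ * f y := by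
  rcases hσ with rfl | rfl
  · have : f (x - y) = 0 := map_eq_zero_of_sin_eq_zero hf (by rw [Real.sin_sub, hc, hs]; ring)
    rw [map_sub] at this; linarith
  · have : f (x + y) = 0 := map_eq_zero_of_sin_eq_zero hf (by rw [Real.sin_add, hc, hs]; ring)
    rw [map_add] at this; linarith

/-! ### The plane as the complex numbers -/

/-- The oriented area of the parallelogram spanned by two vectors of the plane. -/
noncomputable def planeDet (u v : ℂ) : ℝ := u.re * v.im - u.im * v.re

/-- The scalar product of two vectors of the plane. -/
noncomputable def planeDot (u v : ℂ) : ℝ := u.re * v.re + u.im * v.im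

theorem norm_sq_re_im (z : ℂ) : ‖z‖ ^ 2 = z.re ^ 2 + z.im ^ 2 := by
  rw [← Complex.normSq_eq_norm_sq, Complex.normSq_apply]; ring

/-- If `w₀ w₁` is a real multiple of `v²`, the lines spanned by `w₀` and `w₁` are mirror images of
each other in the line spanned by `v`. Here `a₀` and `a₁` are the lengths of `w₀` and `w₁`, up to
a sign for the latter. -/
theorem exists_mirror_form {v w₀ w₁ : ℂ} {l : ℝ} (hv : v ≠ 0) (hl : l ≠ 0)
    (h : w₀ * w₁ = l * v ^ 2) :
    ∃ a₀ a₁ c s : ℝ, a₀ ≠ 0 ∧ a₁ ≠ 0 ∧ c ^ 2 + s ^ 2 = 1 ∧ a₀ * a₁ = l * ‖v‖ ^ 2 ∧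
      w₀ = (a₀ / ‖v‖ : ℝ) * v * (c + s * Complex.I) ∧
      w₁ = (a₁ / ‖v‖ : ℝ) * v * (c - s * Complex.I) := by
  have hw : w₀ ≠ 0 := by
    rintro rfl
    rw [zero_mul] at h
    exact (mul_ne_zero (by exact_mod_cast hl) (pow_ne_zero 2 hv)) h.symm
  have hvn : (‖v‖ : ℂ) ≠ 0 := by exact_mod_cast norm_ne_zero_iff.2 hv
  have hwn : (‖w₀‖ : ℂ) ≠ 0 := by exact_mod_cast norm_ne_zero_iff.2 hw
  have hvn' := norm_ne_zero_iff.2 hv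
  have hwn' := norm_ne_zero_iff.2 hw
  set e : ℂ := w₀ * ‖v‖ / (‖w₀‖ * v) with he
  have hen : ‖e‖ = 1 := by
    rw [he, norm_div, norm_mul, norm_mul, Complex.norm_real, Complex.norm_real, norm_norm,
      norm_norm, div_self (mul_ne_zero hwn' hvn')]
  have hee : e * (starRingEnd ℂ e) = 1 := by
    rw [Complex.mul_conj, Complex.normSq_eq_norm_sq, hen]; simp
  have e1 : (e.re : ℂ) + e.im * Complex.I = e := Complex.re_add_im e
  have e2 : (e.re : ℂ) - e.im * Complex.I = starRingEnd ℂ e := by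
    apply Complex.ext <;> simp
  have hw₀ : w₀ = (‖w₀‖ / ‖v‖ : ℝ) * v * e := by
    rw [he]; push_cast; field_simp
  refine ⟨‖w₀‖, l * ‖v‖ ^ 2 / ‖w₀‖, e.re, e.im, hwn', by positivity, ?_, by field_simp, ?_, ?_⟩
  · rw [← norm_sq_re_im, hen, one_pow]
  · rw [e1]; exact hw₀
  · rw [e2]
    apply mul_left_cancel₀ hw
    rw [h]
    have hw₀' : w₀ * ‖v‖ = ‖w₀‖ * v * e := by rw [he]; field_simp
    generalize starRingEnd ℂ e = e' at *
    push_cast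
    field_simp
    linear_combination -(l * e' : ℂ) * hw₀' - l * ‖w₀‖ * v * hee

/-- The number `1 - cos β`, where `β` is the angle by which an edge has been folded from the planar
position with directions `x` of the edge and `y₀`, `y₁` of the adjacent faces to the position with
dihedral angle `α`: the planar dihedral angle is `0` or `π` according to the sign. -/
noncomputable def fold (x y₀ y₁ : ℂ) (α : ℝ) : ℝ :=
  1 - (SignType.sign (planeDet x y₀ * planeDet x y₁) : ℝ) * Real.cos α

theorem sign_sq_of_ne_zero {x : ℝ} (h : x ≠ 0) : (SignType.sign x : ℝ) ^ 2 = 1 := by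
  rcases lt_or_gt_of_ne h with h | h <;> simp [h]

theorem sign_eq_one_or {x : ℝ} (h : x ≠ 0) :
    (SignType.sign x : ℝ) = 1 ∨ (SignType.sign x : ℝ) = -1 := by
  rcases lt_or_gt_of_ne h with h | h <;> simp [h]

theorem sin_sq_of_fold {x y₀ y₁ : ℂ} (α : ℝ) (h₀ : planeDet x y₀ ≠ 0) (h₁ : planeDet x y₁ ≠ 0) :
    fold x y₀ y₁ α * (2 - fold x y₀ y₁ α) = Real.sin α ^ 2 := by
  have := sign_sq_of_ne_zero (mul_ne_zero h₀ h₁)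
  rw [fold, Real.sin_sq]
  linear_combination (- Real.cos α ^ 2) * this

theorem fold_congr {x x' y₀ y₁ y₀' y₁' : ℂ} (α : ℝ) {r : ℝ} (hr : 0 < r)
    (h : planeDet x' y₀' * planeDet x' y₁' = r * (planeDet x y₀ * planeDet x y₁)) :
    fold x' y₀' y₁' α = fold x y₀ y₁ α := by
  rw [fold, fold, h, sign_mul, sign_pos hr, one_mul]

/-! ### The link of a vertex -/

/-- The dihedral angle at an edge in terms of unit vectors `p`, `q₀`, `q₁` along the edges. The
number `d` is the product of the sines of the two plane angles, up to sign. -/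
theorem EdgeAngle.of_unit {ε a b₀ b₁ x y d α : ℝ} {p q₀ q₁ : E3} (hp : ‖p‖ = 1) (hq₀ : ‖q₀‖ = 1)
    (hq₁ : ‖q₁‖ = 1) (hx : inner ℝ p q₀ = x) (hy : inner ℝ p q₁ = y) (ha : a ≠ 0) (hb₀ : b₀ ≠ 0)
    (hb₁ : b₁ ≠ 0) (hd : d ≠ 0) (hxy : (1 - x ^ 2) * (1 - y ^ 2) = d ^ 2)
    (h : EdgeAngle ε (a • p) (b₀ • q₀) (b₁ • q₁) α) :
    (SignType.sign (b₀ * b₁ * d) : ℝ) * Real.cos α * d = inner ℝ q₀ q₁ - x * y ∧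
      Real.sin α * |d| = ε * SignType.sign a * SignType.sign (b₀ * b₁) *
        inner ℝ (cross p q₀) q₁ := by
  have hn : ‖cross p q₀‖ * ‖cross p q₁‖ = |d| := by
    rw [← abs_of_nonneg (show 0 ≤ ‖cross p q₀‖ * ‖cross p q₁‖ by positivity)]
    apply (sq_eq_sq_iff_abs_eq_abs _ _).1
    rw [mul_pow, norm_cross_sq, norm_cross_sq, hp, hq₀, hq₁, hx, hy, ← hxy]; ring
  have hN : ‖cross (a • p) (b₀ • q₀)‖ * ‖cross (a • p) (b₁ • q₁)‖ = a ^ 2 * |b₀ * b₁| * |d| := by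
    rw [cross_smul_smul, cross_smul_smul, norm_smul, norm_smul, ← hn, Real.norm_eq_abs,
      Real.norm_eq_abs, abs_mul, abs_mul, abs_mul, ← sq_abs a]; ring
  obtain ⟨hc, hs⟩ := h
  rw [hN, cross_smul_smul, cross_smul_smul, inner_smul_left, inner_smul_right, inner_cross_cross,
    real_inner_self_eq_norm_sq, hp, hy, real_inner_comm p q₀, hx, RCLike.conj_to_real] at hc
  rw [hN, cross_smul_smul, inner_smul_left, inner_smul_right, norm_smul, hp, Real.norm_eq_abs,
    RCLike.conj_to_real] at hs
  have hb := mul_ne_zero hb₀ hb₁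
  have ht : (SignType.sign (b₀ * b₁) : ℝ) * |b₀ * b₁| = b₀ * b₁ := sign_mul_abs _
  have hdd : (SignType.sign d : ℝ) * |d| = d := sign_mul_abs _
  have haa : (SignType.sign a : ℝ) * |a| = a := sign_mul_abs _
  have st := sign_sq_of_ne_zero hb
  have sd := sign_sq_of_ne_zero hd
  have sa := sign_sq_of_ne_zero ha
  have hap : |a| ≠ 0 := abs_ne_zero.2 ha
  have hbp : |b₀ * b₁| ≠ 0 := abs_ne_zero.2 hb
  have ha2 : a ^ 2 = |a| ^ 2 := (sq_abs a).symm
  constructor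
  · rw [sign_mul, SignType.coe_mul]
    apply mul_left_cancel₀ (mul_ne_zero (pow_ne_zero 2 ha) hb)
    generalize (SignType.sign (b₀ * b₁) : ℝ) = t at *
    generalize (SignType.sign d : ℝ) = u at *
    generalize |b₀ * b₁| = B at *
    generalize |d| = D at *
    subst hdd
    linear_combination hc - a ^ 2 * t * u^2 * Real.cos α * D * ht + a^2 * B * u^2* D * Real.cos α * st + a^2 * B * D * Real.cos α * sd
  · apply mul_left_cancel₀ (mul_ne_zero (pow_ne_zero 2 ha) hbp)
    generalize (SignType.sign (b₀ * b₁) : ℝ) = t at *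
    generalize (SignType.sign a : ℝ) = u at *
    rw [← mul_assoc]
    have e : b₀ * b₁ = t * |b₀ * b₁| := ht.symm
    generalize |b₀ * b₁| = B at *
    have e2 : ε * (|a| * 1 * (a * b₀ * (b₁ * inner ℝ (cross p q₀) q₁))) =
      ε * (|a| * a) * (b₀ * b₁) * inner ℝ (cross p q₀) q₁ := by ring
    rw [e2, e] at hs
    have e3 : a ^ 2 * u = |a| * a := by rw [ha2]; linear_combination |a| * haa
    linear_combination hs - ε * t * B * inner ℝ (cross p q₀) q₁ * e3

/-- At a vertex of an octahedron, consider the edges in the directions `W 0`, `U 0`, `W 1`, `U 1`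
with dihedral angles `α 0`, `γ 0`, `α 1`, `γ 1`, and the directions `w`, `u` of these edges in a
planar position in which the lines of both pairs of opposite edges are mirror images of each other
in the line spanned by `v`. Opposite edges are folded by angles of the same absolute value, and
there are two modes: the tangents of half the folding angles of adjacent edges are in the ratio of
the sines (first mode) or of the cosines (second mode) of the angles between the edges and `v`. -/
theorem link_dichotomy {f : ℝ →ₗ[ℚ] ℝ} (hf : f Real.pi = 0) {v : ℂ} (hv : v ≠ 0)
    {w u : Fin 2 → ℂ} {l m : ℝ} (hl : l ≠ 0) (hm : m ≠ 0)
    (hw : w 0 * w 1 = l * v ^ 2) (hu : u 0 * u 1 = m * v ^ 2)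
    (hdet : ∀ i j, planeDet (w i) (u j) ≠ 0)
    {W U : Fin 2 → E3} (hW : ∀ i, ‖W i‖ = ‖w i‖) (hU : ∀ i, ‖U i‖ = ‖u i‖)
    (hWU : ∀ i j, inner ℝ (W i) (U j) = planeDot (w i) (u j))
    {R S : ℝ} (hR : planeDet v (w 0) ^ 2 = R * ‖w 0‖ ^ 2)
    (hS : planeDet v (u 0) ^ 2 = S * ‖u 0‖ ^ 2) {ε ε' : ℝ} {α γ : Fin 2 → ℝ}
    (hα : ∀ i : Fin 2, EdgeAngle (ε * (-1) ^ (i.val)) (W i) (U 0) (U 1) (α i))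
    (hγ : ∀ i : Fin 2, EdgeAngle (ε' * (-1) ^ (i.val)) (U i) (W 0) (W 1) (γ i)) :
    let X := fun i => fold (w i) (u 0) (u 1) (α i)
    let Y := fun i => fold (u i) (w 0) (w 1) (γ i)
    R ≠ S ∧ X 0 = X 1 ∧ Y 0 = Y 1 ∧
    ((R * (X 0 * (2 - Y 0)) = S * (Y 0 * (2 - X 0)) ∧
        f (α 0) = - SignType.sign l * f (α 1) ∧ f (γ 0) = - SignType.sign m * f (γ 1)) ∨
      ((‖v‖ ^ 2 - R) * (X 0 * (2 - Y 0)) = (‖v‖ ^ 2 - S) * (Y 0 * (2 - X 0)) ∧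
        f (α 0) = SignType.sign l * f (α 1) ∧ f (γ 0) = SignType.sign m * f (γ 1))) := by
  intro X Y
  obtain ⟨a₀, a₁, c, s, ha₀, ha₁, hcs, ha, hw₀, hw₁⟩ := exists_mirror_form hv hl hw
  obtain ⟨b₀, b₁, c', s', hb₀, hb₁, hcs', hb, hu₀, hu₁⟩ := exists_mirror_form hv hm hu
  have hr : ‖v‖ ≠ 0 := norm_ne_zero_iff.2 hv
  have hr2 := norm_sq_re_im v
  have hrp : 0 < ‖v‖ ^ 2 := by positivity
  set r := ‖v‖ with hrdef
  -- planar scalar products and determinants in the mirror form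
  have dot_form : ∀ a b x y x' y' : ℝ,
      planeDot ((a / r : ℝ) * v * (x + y * Complex.I)) ((b / r : ℝ) * v * (x' + y' * Complex.I)) =
        a * b * (x * x' + y * y') := by
    intro a b x y x' y'
    simp only [planeDot, Complex.mul_re, Complex.mul_im, Complex.add_re, Complex.add_im,
      Complex.ofReal_re, Complex.ofReal_im, Complex.I_re, Complex.I_im]
    field_simp
    rw [hr2]; ring
  have det_form : ∀ a b x y x' y' : ℝ,
      planeDet ((a / r : ℝ) * v * (x + y * Complex.I)) ((b / r : ℝ) * v * (x' + y' * Complex.I)) =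
        a * b * (x * y' - y * x') := by
    intro a b x y x' y'
    simp only [planeDet, Complex.mul_re, Complex.mul_im, Complex.add_re, Complex.add_im,
      Complex.ofReal_re, Complex.ofReal_im, Complex.I_re, Complex.I_im]
    field_simp
    rw [hr2]; ring
  have detv_form : ∀ a x y : ℝ,
      planeDet v ((a / r : ℝ) * v * (x + y * Complex.I)) = r * a * y := by
    intro a x y
    simp only [planeDet, Complex.mul_re, Complex.mul_im, Complex.add_re, Complex.add_im,
      Complex.ofReal_re, Complex.ofReal_im, Complex.I_re, Complex.I_im]
    field_simp
    rw [hr2]; ring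
  have norm_form : ∀ a x y : ℝ, x ^ 2 + y ^ 2 = 1 →
      ‖((a / r : ℝ) : ℂ) * v * (x + y * Complex.I)‖ = |a| := by
    intro a x y h
    have : ‖(x + y * Complex.I : ℂ)‖ = 1 := by
      have h2 := norm_sq_re_im (x + y * Complex.I : ℂ)
      simp [h] at h2
      exact h2.resolve_right (fun h3 => by
        have := norm_nonneg (x + y * Complex.I : ℂ); linarith)
    rw [norm_mul, norm_mul, this, Complex.norm_real, Real.norm_eq_abs, abs_div, ← hrdef,
      abs_of_nonneg (show 0 ≤ r from norm_nonneg v)]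
    field_simp
  have neg_form : ∀ x y : ℝ, (x - y * Complex.I : ℂ) = x + (-y : ℝ) * Complex.I := by
    intro x y; push_cast; ring
  rw [neg_form] at hw₁ hu₁
  have hcsn : c ^ 2 + (-s) ^ 2 = 1 := by rw [neg_sq, hcs]
  have hcsn' : c' ^ 2 + (-s') ^ 2 = 1 := by rw [neg_sq, hcs']
  -- the radii of the circles touched by the lines
  have hR' : R = r ^ 2 * s ^ 2 := by
    rw [hw₀, detv_form, norm_form _ _ _ hcs, sq_abs] at hR
    have : a₀ ^ 2 * R = a₀ ^ 2 * (r ^ 2 * s ^ 2) := by linarith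
    exact mul_left_cancel₀ (pow_ne_zero 2 ha₀) this
  have hS' : S = r ^ 2 * s' ^ 2 := by
    rw [hu₀, detv_form, norm_form _ _ _ hcs', sq_abs] at hS
    have : b₀ ^ 2 * S = b₀ ^ 2 * (r ^ 2 * s' ^ 2) := by linarith
    exact mul_left_cancel₀ (pow_ne_zero 2 hb₀) this
  -- unit vectors along the edges
  have unit : ∀ {Z : E3} {z : ℂ} {a x y : ℝ}, x ^ 2 + y ^ 2 = 1 → a ≠ 0 → ‖Z‖ = ‖z‖ →
      z = (a / r : ℝ) * v * (x + y * Complex.I) → ∃ p : E3, ‖p‖ = 1 ∧ Z = a • p := by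
    intro Z z a x y hxy ha hZ hz
    refine ⟨a⁻¹ • Z, ?_, by rw [smul_smul, mul_inv_cancel₀ ha, one_smul]⟩
    rw [norm_smul, hZ, hz, norm_form _ _ _ hxy, norm_inv, Real.norm_eq_abs,
      inv_mul_cancel₀ (abs_ne_zero.2 ha)]
  obtain ⟨p₀, hp₀, hP₀⟩ := unit hcs ha₀ (hW 0) hw₀
  obtain ⟨p₁, hp₁, hP₁⟩ := unit hcsn ha₁ (hW 1) hw₁
  obtain ⟨q₀, hq₀, hQ₀⟩ := unit hcs' hb₀ (hU 0) hu₀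
  obtain ⟨q₁, hq₁, hQ₁⟩ := unit hcsn' hb₁ (hU 1) hu₁
  have ip : ∀ {p q : E3} {a b t : ℝ}, a ≠ 0 → b ≠ 0 → inner ℝ (a • p) (b • q) = a * b * t →
      inner ℝ p q = t := by
    intro p q a b t ha hb h
    rw [inner_smul_left, inner_smul_right, RCLike.conj_to_real] at h
    exact mul_left_cancel₀ (mul_ne_zero ha hb) (by linarith)
  have h₀₀ := hWU 0 0
  have h₀₁ := hWU 0 1
  have h₁₀ := hWU 1 0
  have h₁₁ := hWU 1 1
  rw [hP₀, hQ₀, hw₀, hu₀, dot_form] at h₀₀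
  rw [hP₀, hQ₁, hw₀, hu₁, dot_form] at h₀₁
  rw [hP₁, hQ₀, hw₁, hu₀, dot_form] at h₁₀
  rw [hP₁, hQ₁, hw₁, hu₁, dot_form] at h₁₁
  replace h₀₀ : inner ℝ p₀ q₀ = c * c' + s * s' := ip ha₀ hb₀ h₀₀
  replace h₀₁ : inner ℝ p₀ q₁ = c * c' - s * s' := by rw [ip ha₀ hb₁ h₀₁]; ring
  replace h₁₀ : inner ℝ p₁ q₀ = c * c' - s * s' := by rw [ip ha₁ hb₀ h₁₀]; ring
  replace h₁₁ : inner ℝ p₁ q₁ = c * c' + s * s' := by rw [ip ha₁ hb₁ h₁₁]; ring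
  have g₀₀ : inner ℝ q₀ p₀ = c * c' + s * s' := by rw [real_inner_comm, h₀₀]
  have g₁₁ : inner ℝ q₁ p₁ = c * c' + s * s' := by rw [real_inner_comm, h₁₁]
  have g₁₀ : inner ℝ q₁ p₀ = c * c' - s * s' := by rw [real_inner_comm, h₀₁]
  have g₀₁ : inner ℝ q₀ p₁ = c * c' - s * s' := by rw [real_inner_comm, h₁₀]
  have hd : s ^ 2 - s' ^ 2 ≠ 0 := by
    intro h
    have e₀ := hdet 0 0
    have e₁ := hdet 0 1
    rw [hw₀, hu₀, det_form] at e₀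
    rw [hw₀, hu₁, det_form] at e₁
    have : (c * s' - s * c') * (c * -s' - s * c') = 0 := by
      linear_combination h + s ^ 2 * hcs' - s' ^ 2 * hcs
    rcases mul_eq_zero.1 this with h | h
    · exact e₀ (by rw [h, mul_zero])
    · exact e₁ (by rw [h, mul_zero])
  have hd' : s' ^ 2 - s ^ 2 ≠ 0 := by
    intro h; apply hd; linarith
  have hxy : (1 - (c * c' + s * s') ^ 2) * (1 - (c * c' - s * s') ^ 2) = (s ^ 2 - s' ^ 2) ^ 2 := by
    have e1 : c ^ 2 = 1 - s ^ 2 := by linarith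
    have e2 : c' ^ 2 = 1 - s' ^ 2 := by linarith
    have : (1 - (c * c' + s * s') ^ 2) * (1 - (c * c' - s * s') ^ 2) =
        1 - 2 * (c ^ 2 * c' ^ 2 + s ^ 2 * s' ^ 2) + (c ^ 2 * c' ^ 2 - s ^ 2 * s' ^ 2) ^ 2 := by ring
    rw [this, e1, e2]; ring
  have hxy' : (1 - (c * c' - s * s') ^ 2) * (1 - (c * c' + s * s') ^ 2) = (s ^ 2 - s' ^ 2) ^ 2 := by
    rw [mul_comm, hxy]
  have hyx : (1 - (c * c' + s * s') ^ 2) * (1 - (c * c' - s * s') ^ 2) = (s' ^ 2 - s ^ 2) ^ 2 := by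
    rw [hxy]; ring
  have hyx' : (1 - (c * c' - s * s') ^ 2) * (1 - (c * c' + s * s') ^ 2) = (s' ^ 2 - s ^ 2) ^ 2 := by
    rw [hxy']; ring
  have A₀ := hα 0
  have A₁ := hα 1
  have G₀ := hγ 0
  have G₁ := hγ 1
  rw [hP₀, hQ₀, hQ₁] at A₀
  rw [hP₁, hQ₀, hQ₁] at A₁
  rw [hQ₀, hP₀, hP₁] at G₀
  rw [hQ₁, hP₀, hP₁] at G₁
  obtain ⟨A₀c, A₀s⟩ := A₀.of_unit hp₀ hq₀ hq₁ h₀₀ h₀₁ ha₀ hb₀ hb₁ hd hxy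
  obtain ⟨A₁c, A₁s⟩ := A₁.of_unit hp₁ hq₀ hq₁ h₁₀ h₁₁ ha₁ hb₀ hb₁ hd hxy'
  obtain ⟨G₀c, G₀s⟩ := G₀.of_unit hq₀ hp₀ hp₁ g₀₀ g₀₁ hb₀ ha₀ ha₁ hd' hyx
  obtain ⟨G₁c, G₁s⟩ := G₁.of_unit hq₁ hp₀ hp₁ g₁₀ g₁₁ hb₁ ha₀ ha₁ hd' hyx'
  have sq_pos' : ∀ {x : ℝ}, x ≠ 0 → (SignType.sign (x ^ 2)) = 1 :=
    fun h => sign_pos (by positivity)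
  have κ : ∀ {a b₀ b₁ x y x' y' d : ℝ}, a ≠ 0 →
      (x * y' - y * x') * (x * -y' - y * x') = d →
      SignType.sign (a * b₀ * (x * y' - y * x') * (a * b₁ * (x * -y' - y * x'))) =
        SignType.sign (b₀ * b₁ * d) := by
    intro a b₀ b₁ x y x' y' d ha h
    rw [← h, show a * b₀ * (x * y' - y * x') * (a * b₁ * (x * -y' - y * x')) =
      a ^ 2 * (b₀ * b₁ * ((x * y' - y * x') * (x * -y' - y * x'))) by ring, sign_mul, sq_pos' ha,
      one_mul]
  have X₀ : (s ^ 2 - s' ^ 2) * (1 - X 0) = inner ℝ q₀ q₁ - 1 + s ^ 2 + s' ^ 2 := by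
    simp only [X, fold, hw₀, hu₀, hu₁, det_form]
    rw [κ (d := s ^ 2 - s' ^ 2) ha₀ (by linear_combination s ^ 2 * hcs' - s' ^ 2 * hcs)]
    linear_combination A₀c - c' ^ 2 * hcs + (s ^ 2 - 1) * hcs'
  have X₁ : (s ^ 2 - s' ^ 2) * (1 - X 1) = inner ℝ q₀ q₁ - 1 + s ^ 2 + s' ^ 2 := by
    simp only [X, fold, hw₁, hu₀, hu₁, det_form]
    rw [κ (d := s ^ 2 - s' ^ 2) ha₁ (by linear_combination s ^ 2 * hcs' - s' ^ 2 * hcs)]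
    linear_combination A₁c - c' ^ 2 * hcs + (s ^ 2 - 1) * hcs'
  have Y₀ : (s' ^ 2 - s ^ 2) * (1 - Y 0) = inner ℝ p₀ p₁ - 1 + s ^ 2 + s' ^ 2 := by
    simp only [Y, fold, hu₀, hw₀, hw₁, det_form]
    rw [κ (d := s' ^ 2 - s ^ 2) hb₀ (by linear_combination - s ^ 2 * hcs' + s' ^ 2 * hcs)]
    linear_combination G₀c - c' ^ 2 * hcs + (s ^ 2 - 1) * hcs'
  have Y₁ : (s' ^ 2 - s ^ 2) * (1 - Y 1) = inner ℝ p₀ p₁ - 1 + s ^ 2 + s' ^ 2 := by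
    simp only [Y, fold, hu₁, hw₀, hw₁, det_form]
    rw [κ (d := s' ^ 2 - s ^ 2) hb₁ (by linear_combination - s ^ 2 * hcs' + s' ^ 2 * hcs)]
    linear_combination G₁c - c' ^ 2 * hcs + (s ^ 2 - 1) * hcs'
  have hX : X 0 = X 1 := by
    have := mul_left_cancel₀ hd (X₀.trans X₁.symm); linarith
  have hY : Y 0 = Y 1 := by
    have := mul_left_cancel₀ hd' (Y₀.trans Y₁.symm); linarith
  have hcosα : Real.cos (α 0) = Real.cos (α 1) := by
    have := A₀c.trans ((congrArg _ (mul_comm _ _)).trans A₁c.symm)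
    have hk := sign_eq_one_or (mul_ne_zero (mul_ne_zero hb₀ hb₁) hd)
    have h2 := mul_right_cancel₀ hd this
    refine mul_left_cancel₀ ?_ h2
    rcases hk with h | h <;> rw [h] <;> norm_num
  have hcosγ : Real.cos (γ 0) = Real.cos (γ 1) := by
    have := G₀c.trans ((congrArg _ (mul_comm _ _)).trans G₁c.symm)
    have hk := sign_eq_one_or (mul_ne_zero (mul_ne_zero ha₀ ha₁) hd')
    have h2 := mul_right_cancel₀ hd' this
    refine mul_left_cancel₀ ?_ h2
    rcases hk with h | h <;> rw [h] <;> norm_num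
  have sign_l : (SignType.sign l : ℝ) = SignType.sign a₀ * SignType.sign a₁ := by
    rw [← SignType.coe_mul, ← sign_mul, ha, sign_mul, sign_pos hrp, mul_one]
  have sign_m : (SignType.sign m : ℝ) = SignType.sign b₀ * SignType.sign b₁ := by
    rw [← SignType.coe_mul, ← sign_mul, hb, sign_mul, sign_pos hrp, mul_one]
  -- the relation of the sines of opposite angles, from the relation of the triple products
  have sines : ∀ {x y ε a₀ a₁ k t t' τ d : ℝ}, a₁ ≠ 0 → d ≠ 0 →
      Real.sin x * |d| = ε * (-1) ^ ((0 : Fin 2) : ℕ) * SignType.sign a₀ * k * t →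
      Real.sin y * |d| = ε * (-1) ^ ((1 : Fin 2) : ℕ) * SignType.sign a₁ * k * t' → t = τ * t' →
      Real.sin x = -τ * (SignType.sign a₀ * SignType.sign a₁) * Real.sin y := by
    intro x y ε a₀ a₁ k t t' τ d ha hd h h' ht
    apply mul_right_cancel₀ (abs_ne_zero.2 hd)
    have := sign_sq_of_ne_zero ha
    simp only [Fin.val_zero, Fin.val_one, pow_zero, pow_one] at h h'
    subst ht
    linear_combination h + τ * (SignType.sign a₀ * SignType.sign a₁) * h' -
      ε * (SignType.sign a₀) * k * τ * t' * this
  have hsl : (SignType.sign l : ℝ) = 1 ∨ (SignType.sign l : ℝ) = -1 := sign_eq_one_or hl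
  have hsm : (SignType.sign m : ℝ) = 1 ∨ (SignType.sign m : ℝ) = -1 := sign_eq_one_or hm
  have hsl' : (-SignType.sign l : ℝ) = 1 ∨ (-SignType.sign l : ℝ) = -1 := by
    rcases hsl with h | h <;> rw [h] <;> norm_num
  have hsm' : (-SignType.sign m : ℝ) = 1 ∨ (-SignType.sign m : ℝ) = -1 := by
    rcases hsm with h | h <;> rw [h] <;> norm_num
  have hRS : R ≠ S := by
    intro h
    rw [hR', hS'] at h
    exact hd (sub_eq_zero.2 (mul_left_cancel₀ hrp.ne' h))
  refine ⟨hRS, hX, hY, ?_⟩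
  have cancel : ∀ {x y : ℝ}, (s ^ 2 - s' ^ 2) * (s ^ 2 - s' ^ 2) * x =
      (s ^ 2 - s' ^ 2) * (s ^ 2 - s' ^ 2) * y → x = y :=
    fun h => mul_left_cancel₀ (mul_ne_zero hd hd) h
  have X₀m : (s ^ 2 - s' ^ 2) * X 0 = 1 - inner ℝ q₀ q₁ - 2 * s' ^ 2 := by linarith
  have X₀p : (s ^ 2 - s' ^ 2) * (2 - X 0) = inner ℝ q₀ q₁ - 1 + 2 * s ^ 2 := by linarith
  have Y₀m : (s ^ 2 - s' ^ 2) * Y 0 = 2 * s ^ 2 - (1 - inner ℝ p₀ p₁) := by linarith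
  have Y₀p : (s ^ 2 - s' ^ 2) * (2 - Y 0) = 1 - inner ℝ p₀ p₁ - 2 * s' ^ 2 := by linarith
  have e1 : (s ^ 2 - s' ^ 2) * (s ^ 2 - s' ^ 2) * (X 0 * (2 - Y 0)) =
      (1 - inner ℝ q₀ q₁ - 2 * s' ^ 2) * (1 - inner ℝ p₀ p₁ - 2 * s' ^ 2) := by
    rw [← X₀m, ← Y₀p]; ring
  have e2 : (s ^ 2 - s' ^ 2) * (s ^ 2 - s' ^ 2) * (Y 0 * (2 - X 0)) =
      (2 * s ^ 2 - (1 - inner ℝ p₀ p₁)) * (inner ℝ q₀ q₁ - 1 + 2 * s ^ 2) := by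
    rw [← X₀p, ← Y₀m]; ring
  rcases spherical_isogram hp₀ hp₁ hq₀ hq₁ h₀₀ h₁₁ h₀₁ h₁₀ with ⟨hDE, ht, ht'⟩ | ⟨hDE, ht, ht'⟩
  · left
    refine ⟨?_, ?_, ?_⟩
    · rw [hR', hS']
      apply cancel
      linear_combination r ^ 2 * s ^ 2 * e1 - r ^ 2 * s' ^ 2 * e2 +
        r ^ 2 * (s ^ 2 - s' ^ 2) * hDE
    · apply map_eq_mul_map hf hsl' hcosα
      rw [sines ha₁ hd A₀s A₁s (by rw [ht, one_mul]), sign_l]; ring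
    · apply map_eq_mul_map hf hsm' hcosγ
      rw [sines hb₁ hd' G₀s G₁s (by rw [ht', one_mul]), sign_m]; ring
  · right
    refine ⟨?_, ?_, ?_⟩
    · have e3 : r ^ 2 - R = r ^ 2 * c ^ 2 := by rw [hR']; linear_combination - r ^ 2 * hcs
      have e4 : r ^ 2 - S = r ^ 2 * c' ^ 2 := by rw [hS']; linear_combination - r ^ 2 * hcs'
      have f1 : s ^ 2 = 1 - c ^ 2 := by linarith
      have f2 : s' ^ 2 = 1 - c' ^ 2 := by linarith
      rw [e3, e4]
      apply cancel
      have e1' := e1.trans (by rw [f2])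
      have e2' := e2.trans (by rw [f1])
      linear_combination r ^ 2 * c ^ 2 * e1' - r ^ 2 * c' ^ 2 * e2' +
        r ^ 2 * (c ^ 2 - c' ^ 2) * hDE
    · apply map_eq_mul_map hf hsl hcosα
      rw [sines ha₁ hd A₀s A₁s (by rw [ht, neg_one_mul]), sign_l]; ring
    · apply map_eq_mul_map hf hsm hcosγ
      rw [sines hb₁ hd' G₀s G₁s (by rw [ht', neg_one_mul]), sign_m]; ring

/-! ### Combination of the modes at the six vertices -/

theorem add_one_one (k : Fin 3) : k + 1 + 1 = k + 2 := by revert k; decide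

theorem add_one_two (k : Fin 3) : k + 1 + 2 = k := by revert k; decide

theorem add_two_one (k : Fin 3) : k + 2 + 1 = k := by revert k; decide

theorem add_two_two (k : Fin 3) : k + 2 + 2 = k + 1 := by revert k; decide

theorem both_flat {R S x y : ℝ} (hRS : R ≠ S) (h : x * (2 - y) = y * (2 - x))
    (h' : R * (x * (2 - y)) = S * (y * (2 - x))) : x * (2 - x) = 0 ∧ y * (2 - y) = 0 := by
  have hxy : x = y := by linarith
  subst hxy
  have : (R - S) * (x * (2 - x)) = 0 := by linarith
  have := (mul_eq_zero.1 this).resolve_left (sub_ne_zero.2 hRS)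
  exact ⟨this, this⟩

theorem flat_of_flat {a b x y : ℝ} (ha : a ≠ 0) (hb : b ≠ 0)
    (h : a * (x * (2 - y)) = b * (y * (2 - x))) (hx : x * (2 - x) = 0) : y * (2 - y) = 0 := by
  rcases mul_eq_zero.1 hx with rfl | hx
  · have : b * (y * 2) = 0 := by linarith
    have := (mul_eq_zero.1 this).resolve_left hb
    have : y = 0 := by linarith
    rw [this, zero_mul]
  · have hx2 : x = 2 := by linarith
    subst hx2
    have : a * (2 - y) = 0 := by linarith
    rw [(mul_eq_zero.1 this).resolve_left ha, mul_zero]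

/-- If the vertices of two pairs fold in the first mode, then those of the third pair cannot fold
in the second mode. -/
theorem false_of_single_second_mode {R₀ R₁ R₂ x₀ x₁ x₂ ρ : ℝ} (hR : R₁ ≠ R₂) (hρ : ρ ≠ 0)
    (h₀ : x₀ * (2 - x₀) ≠ 0) (h₁ : x₁ * (2 - x₁) ≠ 0)
    (h₀₁ : R₀ * (x₀ * (2 - x₁)) = R₁ * (x₁ * (2 - x₀)))
    (h₀₂ : R₀ * (x₀ * (2 - x₂)) = R₂ * (x₂ * (2 - x₀)))
    (h₁₂ : (ρ - R₁) * (x₁ * (2 - x₂)) = (ρ - R₂) * (x₂ * (2 - x₁))) : False := by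
  have hx₀ : 2 - x₀ ≠ 0 := right_ne_zero_of_mul h₀
  have e : R₁ * (x₁ * (2 - x₂)) = R₂ * (x₂ * (2 - x₁)) := by
    apply mul_left_cancel₀ hx₀
    linear_combination (2 - x₁) * h₀₂ - (2 - x₂) * h₀₁
  have e' : x₁ * (2 - x₂) = x₂ * (2 - x₁) := by
    apply mul_left_cancel₀ hρ
    linarith
  exact h₁ (both_flat hR e' e).1

/-- The vertex `i` of the pair `k` folds in the first mode of `link_dichotomy`. Here `X k` is the common value of
`fold` at the edges between the pairs `k + 1` and `k + 2`, and `g k i j` are the values of the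
additive function at their dihedral angles; `σ k l` is the sign that distinguishes whether the
edges from a vertex of the pair `k` to the pair `l` point to the same side. -/
structure FirstMode (R X : Fin 3 → ℝ) (g : Fin 3 → Fin 2 → Fin 2 → ℝ) (σ : Fin 3 → Fin 3 → ℝ)
    (k : Fin 3) (i : Fin 2) : Prop where
  ratio : R (k + 2) * (X (k + 2) * (2 - X (k + 1))) = R (k + 1) * (X (k + 1) * (2 - X (k + 2)))
  next : g (k + 2) i 0 = - σ k (k + 1) * g (k + 2) i 1
  prev : g (k + 1) 0 i = - σ k (k + 2) * g (k + 1) 1 i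

/-- The vertex `i` of the pair `k`, at squared distance `ρ` from the center, folds in the second
mode. The notation is that of `FirstMode`. -/
structure SecondMode (R X : Fin 3 → ℝ) (g : Fin 3 → Fin 2 → Fin 2 → ℝ) (σ : Fin 3 → Fin 3 → ℝ)
    (ρ : ℝ) (k : Fin 3) (i : Fin 2) : Prop where
  ratio : (ρ - R (k + 2)) * (X (k + 2) * (2 - X (k + 1))) =
    (ρ - R (k + 1)) * (X (k + 1) * (2 - X (k + 2)))
  next : g (k + 2) i 0 = σ k (k + 1) * g (k + 2) i 1
  prev : g (k + 1) 0 i = σ k (k + 2) * g (k + 1) 1 i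

/-- Unless the edges at a pair of opposite vertices are all unfolded or folded flat, both vertices
fold in the same mode, and the second mode requires equal distances from the center. -/
theorem modes_of_pair {R X : Fin 3 → ℝ} {g : Fin 3 → Fin 2 → Fin 2 → ℝ} {σ : Fin 3 → Fin 3 → ℝ}
    {ρ : Fin 2 → ℝ} {k : Fin 3} (hR : R (k + 2) ≠ R (k + 1)) (hρ : ∀ i, ρ i ≠ 0)
    (h : ∀ i, FirstMode R X g σ k i ∨ SecondMode R X g σ (ρ i) k i) :
    (∀ i, FirstMode R X g σ k i) ∨ (ρ 0 = ρ 1 ∧ ∀ i, SecondMode R X g σ (ρ i) k i) ∨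
      (X (k + 2) * (2 - X (k + 2)) = 0 ∧ X (k + 1) * (2 - X (k + 1)) = 0) := by
  have mixed : ∀ {i j}, FirstMode R X g σ k i → SecondMode R X g σ (ρ j) k j →
      (X (k + 2) * (2 - X (k + 2)) = 0 ∧ X (k + 1) * (2 - X (k + 1)) = 0) := by
    intro i j h h'
    refine both_flat hR (mul_left_cancel₀ (hρ j) ?_) h.ratio
    linarith [h.ratio, h'.ratio]
  rcases h 0 with h₀ | h₀ <;> rcases h 1 with h₁ | h₁
  · exact Or.inl (Fin.forall_fin_two.2 ⟨h₀, h₁⟩)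
  · exact Or.inr (Or.inr (mixed h₀ h₁))
  · exact Or.inr (Or.inr (mixed h₁ h₀))
  · by_cases he : ρ 0 = ρ 1
    · exact Or.inr (Or.inl ⟨he, Fin.forall_fin_two.2 ⟨h₀, h₁⟩⟩)
    · have e : X (k + 2) * (2 - X (k + 1)) = X (k + 1) * (2 - X (k + 2)) := by
        apply mul_left_cancel₀ (sub_ne_zero.2 he)
        linarith [h₀.ratio, h₁.ratio]
      refine Or.inr (Or.inr (both_flat hR e ?_))
      have := h₀.ratio
      rw [e] at this ⊢
      linarith

/-- The signed sum of the edge lengths vanishes once the modes at the six vertices are combined.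
The last hypotheses exclude or describe the planar positions in which two pairs of opposite
vertices could fold in the second mode. -/
theorem sum_eq_zero_of_modes {R X : Fin 3 → ℝ} {g L : Fin 3 → Fin 2 → Fin 2 → ℝ}
    {σ : Fin 3 → Fin 3 → ℝ} {ρ : Fin 3 → Fin 2 → ℝ} (hR₀ : ∀ k, R k ≠ 0)
    (hR : ∀ k, R (k + 2) ≠ R (k + 1)) (hρ : ∀ k i, ρ k i ≠ 0)
    (hmode : ∀ k i, FirstMode R X g σ k i ∨ SecondMode R X g σ (ρ k i) k i)
    (hflat : ∀ k, X k * (2 - X k) = 0 → ∀ i j, g k i j = 0)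
    (hcirc : ∀ k, ρ k 0 = ρ k 1 → ρ k 0 ≠ R (k + 1) ∧ ρ k 0 ≠ R (k + 2))
    (h₀₁ : ¬ (ρ 0 0 = ρ 0 1 ∧ ρ 1 0 = ρ 1 1)) (h₁₂ : ¬ (ρ 1 0 = ρ 1 1 ∧ ρ 2 0 = ρ 2 1))
    (hfirst : ∀ k, (∀ i, g k i 0 = - σ (k + 1) (k + 2) * g k i 1) →
      (∀ j, g k 0 j = - σ (k + 2) (k + 1) * g k 1 j) → ∑ i, ∑ j, L k i j * g k i j = 0)
    (hsym : ρ 0 0 = ρ 0 1 → ρ 2 0 = ρ 2 1 →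
      ((∀ j, L 2 0 j = L 2 1 j) ∧ (∀ i, L 0 i 0 = L 0 i 1) ∧ L 1 0 0 = L 1 1 1 ∧
        L 1 0 1 = L 1 1 0) ∧ σ 1 0 = 1 ∧ σ 1 2 = 1 ∧ σ 2 0 = - σ 0 2 ∧ σ 0 2 * σ 2 0 = -1) :
    ∑ k, ∑ i, ∑ j, L k i j * g k i j = 0 := by
  have pair := fun k => modes_of_pair (hR k) (hρ k) (hmode k)
  -- flatness spreads from one class of edges to the others
  have spread : ∀ k, (X (k + 2) * (2 - X (k + 2)) = 0 ↔ X (k + 1) * (2 - X (k + 1)) = 0) := by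
    intro k
    rcases pair k with h | ⟨he, h⟩ | h
    · exact ⟨flat_of_flat (hR₀ _) (hR₀ _) (h 0).ratio,
        flat_of_flat (hR₀ _) (hR₀ _) (h 0).ratio.symm⟩
    · obtain ⟨c₁, c₂⟩ := hcirc k he
      exact ⟨flat_of_flat (sub_ne_zero.2 c₂) (sub_ne_zero.2 c₁) (h 0).ratio,
        flat_of_flat (sub_ne_zero.2 c₁) (sub_ne_zero.2 c₂) (h 0).ratio.symm⟩
    · exact ⟨fun _ => h.2, fun _ => h.1⟩
  have s₀ : X 2 * (2 - X 2) = 0 ↔ X 1 * (2 - X 1) = 0 := spread 0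
  have s₁ : X 0 * (2 - X 0) = 0 ↔ X 2 * (2 - X 2) = 0 := spread 1
  by_cases hf : X 0 * (2 - X 0) = 0
  · have hall : ∀ k, X k * (2 - X k) = 0 := by
      intro k; fin_cases k
      · exact hf
      · exact s₀.1 (s₁.1 hf)
      · exact s₁.1 hf
    refine Finset.sum_eq_zero fun k _ => Finset.sum_eq_zero fun i _ =>
      Finset.sum_eq_zero fun j _ => ?_
    rw [hflat k (hall k), mul_zero]
  have f₂ : X 2 * (2 - X 2) ≠ 0 := fun h => hf (s₁.2 h)
  have f₁ : X 1 * (2 - X 1) ≠ 0 := fun h => f₂ (s₀.2 h)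
  have p₀ : (∀ i, FirstMode R X g σ 0 i) ∨ (ρ 0 0 = ρ 0 1 ∧ ∀ i, SecondMode R X g σ (ρ 0 i) 0 i) :=
    (or_assoc.2 (pair 0)).resolve_right fun h => f₁ h.2
  have p₁ : (∀ i, FirstMode R X g σ 1 i) ∨ (ρ 1 0 = ρ 1 1 ∧ ∀ i, SecondMode R X g σ (ρ 1 i) 1 i) :=
    (or_assoc.2 (pair 1)).resolve_right fun h => hf h.1
  have p₂ : (∀ i, FirstMode R X g σ 2 i) ∨ (ρ 2 0 = ρ 2 1 ∧ ∀ i, SecondMode R X g σ (ρ 2 i) 2 i) :=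
    (or_assoc.2 (pair 2)).resolve_right fun h => hf h.2
  have single : ∀ k, X (k + 2) * (2 - X (k + 2)) ≠ 0 →
      X k * (2 - X k) ≠ 0 → R k * (X k * (2 - X (k + 2))) = R (k + 2) * (X (k + 2) * (2 - X k)) →
      R (k + 1) * (X (k + 1) * (2 - X k)) = R k * (X k * (2 - X (k + 1))) →
      SecondMode R X g σ (ρ k 0) k 0 → False := fun k n₂ n₀ r₂ r₁ h =>
    false_of_single_second_mode (hR k) (hρ k 0) n₀ n₂ r₂ r₁.symm h.ratio
  rcases p₀ with p₀ | ⟨e₀, p₀⟩ <;> rcases p₁ with p₁ | ⟨e₁, p₁⟩ <;> rcases p₂ with p₂ | ⟨e₂, p₂⟩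
  · have hall : ∀ k i, FirstMode R X g σ k i := by
      intro k; fin_cases k
      exacts [p₀, p₁, p₂]
    refine Finset.sum_eq_zero fun k _ => hfirst k (fun i => ?_) (fun j => ?_)
    · have h := (hall (k + 1) i).next
      rwa [add_one_two, add_one_one] at h
    · have h := (hall (k + 2) j).prev
      rwa [add_two_two, add_two_one] at h
  · exact (single 2 f₁ f₂ (p₀ 0).ratio (p₁ 0).ratio (p₂ 0)).elim
  · exact (single 1 hf f₁ (p₂ 0).ratio (p₀ 0).ratio (p₁ 0)).elim
  · exact (h₁₂ ⟨e₁, e₂⟩).elim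
  · exact (single 0 f₂ hf (p₁ 0).ratio (p₂ 0).ratio (p₀ 0)).elim
  · obtain ⟨⟨l₂, l₀, l₁, l₁'⟩, t₁₀, t₁₂, t', t⟩ := hsym e₀ e₂
    have a₀ : ∀ i, g 0 i 0 = - σ 1 2 * g 0 i 1 := fun i => (p₁ i).next
    have a₂ : ∀ j, g 2 0 j = - σ 1 0 * g 2 1 j := fun i => (p₁ i).prev
    have b : ∀ j, g 1 0 j = σ 0 2 * g 1 1 j := fun j => (p₀ j).prev
    have c : ∀ i, g 1 i 0 = σ 2 0 * g 1 i 1 := fun i => (p₂ i).next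
    have d₀ : g 1 0 0 = - g 1 1 1 := by rw [b, c, ← mul_assoc, t, neg_one_mul]
    have d₁ : g 1 0 1 = - g 1 1 0 := by rw [b, c 1, t']; ring
    simp only [Fin.sum_univ_three, Fin.sum_univ_two]
    rw [a₀ 0, a₀ 1, a₂ 0, a₂ 1, t₁₀, t₁₂, l₀ 0, l₀ 1, l₂ 0, l₂ 1, l₁, l₁', d₀, d₁]
    ring
  · exact (h₀₁ ⟨e₀, e₁⟩).elim
  · exact (h₀₁ ⟨e₀, e₁⟩).elim

/-! ### Planar positions with concentric circles -/

/-- Three pairs of points of the plane such that, for any two of the pairs, the sums and the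
products of the points, as complex numbers, are in the same real ratio, which is that of the
numbers `m`. Equivalently, the inverses of the pairs have a common midpoint and, for any two of the
pairs, the angles formed by the rays from the origin to their points have common bisectors. -/
structure IsIsogonal (z : Fin 3 → Fin 2 → ℂ) (m : Fin 3 → ℝ) : Prop where
  ne_zero : ∀ k i, z k i ≠ 0
  m_ne_zero : ∀ k, m k ≠ 0
  add_eq : ∀ k l, m k * (z l 0 + z l 1) = m l * (z k 0 + z k 1)
  mul_eq : ∀ k l, m k * (z l 0 * z l 1) = m l * (z k 0 * z k 1)

/-- The six points form the planar position of an octahedron with nondegenerate faces for which the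
lines joining points of the pairs `k + 1` and `k + 2` touch a circle around the origin, whose
radius has the square `R k`. -/
structure IsConcentric (z : Fin 3 → Fin 2 → ℂ) (m R : Fin 3 → ℝ) : Prop extends
    IsIsogonal z m where
  ne : ∀ k, z k 0 ≠ z k 1
  face : ∀ k i j l, planeDet (z (k + 1) j - z k i) (z (k + 2) l - z k i) ≠ 0
  R_pos : ∀ k, 0 < R k
  touch : ∀ k i j, planeDet (z (k + 1) i) (z (k + 2) j) ^ 2 = R k * ‖z (k + 2) j - z (k + 1) i‖ ^ 2

section Concentric

variable {z : Fin 3 → Fin 2 → ℂ} {m R : Fin 3 → ℝ}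

theorem planeDet_swap (u v : ℂ) : planeDet u v = - planeDet v u := by
  simp only [planeDet]; ring

theorem planeDet_sub_self (u v : ℂ) : planeDet u (v - u) = planeDet u v := by
  simp only [planeDet, Complex.sub_re, Complex.sub_im]; ring

theorem planeDet_zero_left (v : ℂ) : planeDet 0 v = 0 := by simp [planeDet]

/-- The edges from a vertex to a pair of opposite vertices lie on lines that are mirror images of
each other in the line through the vertex and the origin. -/
theorem IsIsogonal.mirror (h : IsIsogonal z m) (k l : Fin 3) (i : Fin 2) :
    (z l 0 - z k i) * (z l 1 - z k i) = (1 - m l / m k : ℝ) * z k i ^ 2 := by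
  have hk : (m k : ℂ) ≠ 0 := by exact_mod_cast h.m_ne_zero k
  have ha := h.add_eq k l
  have hm := h.mul_eq k l
  push_cast
  field_simp
  fin_cases i
  · simp only [Fin.zero_eta]
    linear_combination hm - z k 0 * ha
  · simp only [Fin.mk_one]
    linear_combination hm - z k 1 * ha

theorem IsConcentric.vertex_ne_next (h : IsConcentric z m R) (k : Fin 3) (i j : Fin 2) :
    z (k + 1) j ≠ z k i := by
  intro e
  apply h.face k i j 0
  rw [e, sub_self, planeDet_zero_left]

theorem IsConcentric.vertex_ne_prev (h : IsConcentric z m R) (k : Fin 3) (i j : Fin 2) :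
    z (k + 2) j ≠ z k i := by
  have := h.vertex_ne_next (k + 2) j i
  rw [add_two_one] at this
  exact this.symm

theorem IsIsogonal.ratio_ne (h : IsIsogonal z m) {k l : Fin 3}
    (hn : ∀ i j, z l j ≠ z k i) : 1 - m l / m k ≠ 0 := by
  intro e
  have := h.mirror k l 0
  rw [e, Complex.ofReal_zero, zero_mul] at this
  rcases mul_eq_zero.1 this with e | e <;> exact hn _ _ (sub_eq_zero.1 e)

/-- The distance from `a` to the foot of the perpendicular from the origin to the line `ab`,
positive in the direction from `a` to `b`. -/
noncomputable def signedTangent (a b : ℂ) : ℝ := - planeDot (b - a) a / ‖b - a‖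

theorem signedTangent_add (a b : ℂ) (h : b ≠ a) :
    signedTangent a b + signedTangent b a = ‖b - a‖ := by
  have hn : ‖b - a‖ ≠ 0 := norm_ne_zero_iff.2 (sub_ne_zero.2 h)
  rw [signedTangent, signedTangent, norm_sub_rev a b, ← add_div, div_eq_iff hn, ← sq,
    norm_sq_re_im]
  simp only [planeDot, Complex.sub_re, Complex.sub_im]
  ring

theorem signedTangent_mirror {v w₀ w₁ : ℂ} {l : ℝ} (hv : v ≠ 0) (hl : l ≠ 0)
    (h : (w₀ - v) * (w₁ - v) = l * v ^ 2) :
    signedTangent v w₀ = SignType.sign l * signedTangent v w₁ := by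
  obtain ⟨a₀, a₁, c, s, ha₀, ha₁, hcs, ha, hw₀, hw₁⟩ := exists_mirror_form hv hl h
  have hr : ‖v‖ ≠ 0 := norm_ne_zero_iff.2 hv
  have hr2 := norm_sq_re_im v
  have hn : ∀ t : ℝ, c ^ 2 + t ^ 2 = 1 → ‖(c + t * Complex.I : ℂ)‖ = 1 := by
    intro t ht
    have h2 := norm_sq_re_im (c + t * Complex.I : ℂ)
    simp [ht] at h2
    exact h2.resolve_right (fun h3 => by
      have := norm_nonneg (c + t * Complex.I : ℂ); linarith)
  have hs : ∀ a t : ℝ, a ≠ 0 → c ^ 2 + t ^ 2 = 1 → ∀ w : ℂ,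
      w - v = (a / ‖v‖ : ℝ) * v * (c + t * Complex.I) →
      signedTangent v w = - SignType.sign a * (‖v‖ * c) := by
    intro a t ha ht w hw
    have haa : (SignType.sign a : ℝ) * |a| = a := sign_mul_abs _
    rw [signedTangent, hw, norm_mul, norm_mul, hn t ht, Complex.norm_real, Real.norm_eq_abs,
      abs_div, abs_of_nonneg (norm_nonneg v), mul_one, div_mul_cancel₀ _ hr,
      div_eq_iff (abs_ne_zero.2 ha)]
    have e : planeDot ((a / ‖v‖ : ℝ) * v * (c + t * Complex.I)) v = a * ‖v‖ * c := by
      simp only [planeDot, Complex.mul_re, Complex.mul_im, Complex.add_re, Complex.add_im,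
        Complex.ofReal_re, Complex.ofReal_im, Complex.I_re, Complex.I_im]
      field_simp
      rw [hr2]; ring
    rw [e]
    linear_combination ‖v‖ * c * haa
  have e : (c - s * Complex.I : ℂ) = c + (-s : ℝ) * Complex.I := by push_cast; ring
  rw [e] at hw₁
  have sl : (SignType.sign l : ℝ) = SignType.sign a₀ * SignType.sign a₁ := by
    rw [← SignType.coe_mul, ← sign_mul, ha, sign_mul,
      sign_pos (show 0 < ‖v‖ ^ 2 by positivity), mul_one]
  have s₁ := sign_sq_of_ne_zero ha₁
  rw [hs a₀ s ha₀ hcs _ hw₀, hs a₁ (-s) ha₁ (by rw [neg_sq, hcs]) _ hw₁, sl]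
  linear_combination (SignType.sign a₀ * (‖v‖ * c) : ℝ) * s₁

/-- The lengths of the edges between two pairs of opposite vertices, with the signs that belong to
the first mode at all four vertices, add up to zero: each edge is divided by its point of contact,
and the two pieces at each vertex cancel. -/
theorem IsConcentric.sum_mul_eq_zero (h : IsConcentric z m R) {k l : Fin 3}
    (hn : ∀ i j, z l j ≠ z k i) {g : Fin 2 → Fin 2 → ℝ}
    (hk : ∀ i, g i 0 = - (SignType.sign (1 - m l / m k) : ℝ) * g i 1)
    (hl : ∀ j, g 0 j = - (SignType.sign (1 - m k / m l) : ℝ) * g 1 j) :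
    ∑ i, ∑ j, ‖z l j - z k i‖ * g i j = 0 := by
  have a : ∀ i, signedTangent (z k i) (z l 0) * g i 0 + signedTangent (z k i) (z l 1) * g i 1 = 0 := by
    intro i
    have n := h.ratio_ne hn
    rw [signedTangent_mirror (h.ne_zero k i) n (h.mirror k l i), hk]
    linear_combination (- signedTangent (z k i) (z l 1) * g i 1) * sign_sq_of_ne_zero n
  have b : ∀ j, signedTangent (z l j) (z k 0) * g 0 j + signedTangent (z l j) (z k 1) * g 1 j = 0 := by
    intro j
    have n := h.ratio_ne (k := l) (l := k) (fun i j => (hn j i).symm)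
    rw [signedTangent_mirror (h.ne_zero l j) n (h.mirror l k j), hl]
    linear_combination (- signedTangent (z l j) (z k 1) * g 1 j) * sign_sq_of_ne_zero n
  simp only [← signedTangent_add _ _ (hn _ _), Fin.sum_univ_two]
  linear_combination a 0 + a 1 + b 0 + b 1

/-- The tangents at two points of a circle have at most one common point. -/
theorem false_of_common_points_of_tangents {v₀ v₁ w₀ w₁ : ℂ} {r : ℝ} (hr : 0 < r) (hv : v₀ ≠ v₁) (hw : w₀ ≠ w₁)
    (h₀ : ‖v₀‖ ^ 2 = r) (h₁ : ‖v₁‖ ^ 2 = r) (h₀₀ : planeDet v₀ w₀ ^ 2 = r * ‖w₀ - v₀‖ ^ 2)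
    (h₀₁ : planeDet v₀ w₁ ^ 2 = r * ‖w₁ - v₀‖ ^ 2) (h₁₀ : planeDet v₁ w₀ ^ 2 = r * ‖w₀ - v₁‖ ^ 2)
    (h₁₁ : planeDet v₁ w₁ ^ 2 = r * ‖w₁ - v₁‖ ^ 2) : False := by
  have dot : ∀ v w : ℂ, ‖v‖ ^ 2 = r → planeDet v w ^ 2 = r * ‖w - v‖ ^ 2 →
      v.re * w.re + v.im * w.im = r := by
    intro v w hv h
    rw [← hv, norm_sq_re_im, norm_sq_re_im] at h
    rw [norm_sq_re_im] at hv
    simp only [planeDet, Complex.sub_re, Complex.sub_im] at h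
    have : (v.re * w.re + v.im * w.im - (v.re ^ 2 + v.im ^ 2)) ^ 2 = 0 := by
      linear_combination -h
    have := pow_eq_zero_iff two_ne_zero |>.1 this
    linarith
  have d₀₀ := dot _ _ h₀ h₀₀
  have d₀₁ := dot _ _ h₀ h₀₁
  have d₁₀ := dot _ _ h₁ h₁₀
  have d₁₁ := dot _ _ h₁ h₁₁
  rw [norm_sq_re_im] at h₀ h₁
  have hD : 0 < (w₀.re - w₁.re) ^ 2 + (w₀.im - w₁.im) ^ 2 := by
    have := norm_sq_re_im (w₀ - w₁)
    rw [Complex.sub_re, Complex.sub_im] at this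
    rw [← this]
    have := norm_pos_iff.2 (sub_ne_zero.2 hw)
    positivity
  have hV : 0 < (v₀.re - v₁.re) ^ 2 + (v₀.im - v₁.im) ^ 2 := by
    have := norm_sq_re_im (v₀ - v₁)
    rw [Complex.sub_re, Complex.sub_im] at this
    rw [← this]
    have := norm_pos_iff.2 (sub_ne_zero.2 hv)
    positivity
  have hdet : v₀.re * v₁.im - v₀.im * v₁.re = 0 := by
    apply mul_left_cancel₀ hD.ne'
    linear_combination (v₁.im * (w₀.re - w₁.re) - v₁.re * (w₀.im - w₁.im)) * (d₀₀ - d₀₁) -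
      (v₀.im * (w₀.re - w₁.re) - v₀.re * (w₀.im - w₁.im)) * (d₁₀ - d₁₁)
  -- `v₀ + v₁` is parallel and orthogonal to `v₀ - v₁`
  have hsum : (v₀.re + v₁.re) ^ 2 + (v₀.im + v₁.im) ^ 2 = 0 := by
    apply mul_left_cancel₀ hV.ne'
    linear_combination (4 * (v₀.re * v₁.im - v₀.im * v₁.re)) * hdet +
      ((v₀.re ^ 2 + v₀.im ^ 2) - (v₁.re ^ 2 + v₁.im ^ 2)) * (h₀ - h₁)
  have e1 : v₀.re + v₁.re = 0 := by nlinarith [sq_nonneg (v₀.re + v₁.re), sq_nonneg (v₀.im + v₁.im)]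
  have e2 : v₀.im + v₁.im = 0 := by nlinarith [sq_nonneg (v₀.re + v₁.re), sq_nonneg (v₀.im + v₁.im)]
  have : (2 : ℝ) * r = 0 := by
    linear_combination (w₀.re) * e1 + w₀.im * e2 - d₀₀ - d₁₀
  linarith

end Concentric

/-! ### Dihedral angles and folds of a realization -/

section Realization


theorem add_one_ne_self (k : Fin 3) : k + 1 ≠ k := by revert k; decide

theorem add_two_ne_self (k : Fin 3) : k + 2 ≠ k := by revert k; decide

theorem add_two_ne_add_one (k : Fin 3) : k + 2 ≠ k + 1 := by revert k; decide

theorem inner_sub_sub_eq_planeDot {p x y : E3} {a b c : ℂ} (h₁ : dist x p = ‖b - a‖)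
    (h₂ : dist y p = ‖c - a‖) (h₃ : dist x y = ‖b - c‖) :
    inner ℝ (x - p) (y - p) = planeDot (b - a) (c - a) := by
  have e : x - y = (x - p) - (y - p) := by abel
  rw [dist_eq_norm] at h₁ h₂ h₃
  rw [e] at h₃
  have h := norm_sub_sq_real (x - p) (y - p)
  rw [h₁, h₂, h₃, norm_sq_re_im, norm_sq_re_im, norm_sq_re_im] at h
  simp only [Complex.sub_re, Complex.sub_im] at h
  simp only [planeDot, Complex.sub_re, Complex.sub_im]
  linarith

theorem cross_ne_zero_of_planeDet {x y : E3} {b c : ℂ} (h₁ : ‖x‖ = ‖b‖) (h₂ : ‖y‖ = ‖c‖)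
    (h₃ : inner ℝ x y = planeDot b c) (h : planeDet b c ≠ 0) : cross x y ≠ 0 := by
  intro h0
  have := norm_cross_sq x y
  rw [h0, norm_zero, h₁, h₂, h₃, norm_sq_re_im, norm_sq_re_im] at this
  apply h
  apply pow_eq_zero_iff two_ne_zero |>.1
  simp only [planeDet]
  simp only [planeDot] at this
  linarith

theorem cross_sub_rotate (a b c : E3) : cross (b - a) (c - a) = cross (c - b) (a - b) := by
  apply ext_E3 <;> simp only [cross_zero, cross_one, cross_two, PiLp.sub_apply] <;> ring

theorem faceNormal_adjFace (ω : ℤˣ) (P : Octahedron E3) (k : Fin 3) (i j : Fin 2) :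
    faceNormal ω P (adjFace k i j 0) = (((ω : ℤ) : ℝ) * (-1) ^ (i.val + j.val)) •
      NormedSpace.normalize (cross (P (k + 2) j - P (k + 1) i) (P k 0 - P (k + 1) i)) := by
  fin_cases k
  · simp only [faceNormal, adjFace, Fin.zero_eta, zero_add, Fin.isValue]
    rw [cross_sub_rotate]
    simp
  · simp only [faceNormal, adjFace, Fin.mk_one, Fin.isValue]
    rw [cross_sub_rotate, cross_sub_rotate]
    simp [add_comm i.val, show (1 : Fin 3) + 1 = 2 from rfl, show (1 : Fin 3) + 2 = 0 from rfl]
  · simp only [faceNormal, adjFace, Fin.reduceFinMk, Fin.isValue]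
    simp [show (2 : Fin 3) + 1 = 0 from rfl, show (2 : Fin 3) + 2 = 1 from rfl]

theorem units_mul_pow_sq (ω : ℤˣ) (n : ℕ) :
    (((ω : ℤ) : ℝ) * (-1) ^ n) * (((ω : ℤ) : ℝ) * (-1) ^ n) = 1 := by
  rw [mul_mul_mul_comm, ← pow_add, Even.neg_one_pow ⟨n, rfl⟩, mul_one]
  rcases Int.units_eq_one_or ω with rfl | rfl <;> simp

variable {z : Fin 3 → Fin 2 → ℂ} {m R : Fin 3 → ℝ}

theorem IsConcentric.face_next (h : IsConcentric z m R) (k : Fin 3) (i j l : Fin 2) :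
    planeDet (z (k + 2) j - z (k + 1) i) (z k l - z (k + 1) i) ≠ 0 := by
  have := h.face (k + 1) i j l
  rwa [add_one_one, add_one_two] at this

/-- The dihedral angle at an edge, seen from its first end. -/
theorem edgeAngle_of_isDihedralAngle (h : IsConcentric z m R) {P : Octahedron E3}
    (hd : ∀ k l i j, k ≠ l → dist (P k i) (P l j) = ‖z k i - z l j‖) {ω : ℤˣ} {k : Fin 3}
    {i j : Fin 2} {α : ℝ} (hα : IsDihedralAngle ω P k i j α) :
    EdgeAngle (((ω : ℤ) : ℝ) * (-1) ^ (i.val + j.val)) (P (k + 2) j - P (k + 1) i)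
      (P k 0 - P (k + 1) i) (P k 1 - P (k + 1) i) α := by
  have k₁ : k ≠ k + 1 := (add_one_ne_self k).symm
  have k₂ := add_two_ne_add_one k
  have k₃ := add_two_ne_self k
  have hc : ∀ l, cross (P (k + 2) j - P (k + 1) i) (P k l - P (k + 1) i) ≠ 0 := fun l =>
    cross_ne_zero_of_planeDet (by rw [← dist_eq_norm, hd _ _ _ _ k₂])
      (by rw [← dist_eq_norm, hd _ _ _ _ k₁])
      (inner_sub_sub_eq_planeDot (hd _ _ _ _ k₂) (hd _ _ _ _ k₁) (hd _ _ _ _ k₃))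
      (h.face_next k i j l)
  apply EdgeAngle.of_unitPerp (hc 0) (hc 1) _ (units_mul_pow_sq ω _)
  rw [← faceNormal_adjFace]
  exact hα

/-- The folding of the edge `(k, i, j)`, from the planar position `z` to the dihedral angle `α`. -/
noncomputable def edgeFold (z : Fin 3 → Fin 2 → ℂ) (α : Fin 3 → Fin 2 → Fin 2 → ℝ) (k : Fin 3)
    (i j : Fin 2) : ℝ :=
  fold (z (k + 2) j - z (k + 1) i) (z k 0 - z (k + 1) i) (z k 1 - z (k + 1) i) (α k i j)

/-- The two modes at the vertex `i` of the pair `k`. -/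
theorem vertex_dichotomy (h : IsConcentric z m R) {P : Octahedron E3}
    (hd : ∀ k l i j, k ≠ l → dist (P k i) (P l j) = ‖z k i - z l j‖) {ω : ℤˣ}
    {α : Fin 3 → Fin 2 → Fin 2 → ℝ} (hα : ∀ k i j, IsDihedralAngle ω P k i j (α k i j))
    {f : ℝ →ₗ[ℚ] ℝ} (hf : f Real.pi = 0) (k : Fin 3) (i : Fin 2) :
    R (k + 2) ≠ R (k + 1) ∧ edgeFold z α (k + 2) i 0 = edgeFold z α (k + 2) i 1 ∧
      edgeFold z α (k + 1) 0 i = edgeFold z α (k + 1) 1 i ∧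
      ∀ X : Fin 3 → ℝ, X (k + 2) = edgeFold z α (k + 2) i 0 →
        X (k + 1) = edgeFold z α (k + 1) 0 i →
        FirstMode R X (fun k i j => f (α k i j)) (fun k l => SignType.sign (1 - m l / m k)) k i ∨
        SecondMode R X (fun k i j => f (α k i j)) (fun k l => SignType.sign (1 - m l / m k))
          (‖z k i‖ ^ 2) k i := by
  have k₁ := add_one_ne_self k
  have k₂ := add_two_ne_self k
  have k₃ := (add_two_ne_add_one k).symm
  have hα' : ∀ j : Fin 2, EdgeAngle ((((ω : ℤ) : ℝ) * (-1) ^ i.val) * (-1) ^ j.val)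
      (P (k + 1) j - P k i) (P (k + 2) 0 - P k i) (P (k + 2) 1 - P k i) (α (k + 2) i j) := by
    intro j
    have := edgeAngle_of_isDihedralAngle h hd (hα (k + 2) i j)
    rwa [add_two_one, add_two_two, pow_add, ← mul_assoc] at this
  have hγ' : ∀ l : Fin 2, EdgeAngle (-(((ω : ℤ) : ℝ) * (-1) ^ i.val) * (-1) ^ l.val)
      (P (k + 2) l - P k i) (P (k + 1) 0 - P k i) (P (k + 1) 1 - P k i) (α (k + 1) l i) := by
    intro l
    have := (edgeAngle_of_isDihedralAngle h hd (hα (k + 1) l i)).swap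
    rw [add_one_one, add_one_two, add_comm, pow_add] at this
    convert this using 1
    ring
  have t₁ := h.touch (k + 2) i 0
  have t₂ := h.touch (k + 1) 0 i
  rw [add_two_one, add_two_two, ← planeDet_sub_self] at t₁
  rw [add_one_one, add_one_two, planeDet_swap, neg_sq, ← planeDet_sub_self, norm_sub_rev] at t₂
  obtain ⟨hR, hX, hY, hmode⟩ := link_dichotomy hf (h.ne_zero k i)
    (w := fun j => z (k + 1) j - z k i) (u := fun j => z (k + 2) j - z k i)
    (h.ratio_ne (fun i j => h.vertex_ne_next k i j))
    (h.ratio_ne (fun i j => h.vertex_ne_prev k i j))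
    (h.mirror k (k + 1) i) (h.mirror k (k + 2) i) (h.face k i)
    (W := fun j => P (k + 1) j - P k i) (U := fun j => P (k + 2) j - P k i)
    (fun j => by rw [← dist_eq_norm, hd _ _ _ _ k₁]) (fun j => by rw [← dist_eq_norm, hd _ _ _ _ k₂])
    (fun j l => inner_sub_sub_eq_planeDot (hd _ _ _ _ k₁) (hd _ _ _ _ k₂) (hd _ _ _ _ k₃))
    t₁ t₂ hα' hγ'
  have e₁ : ∀ j, edgeFold z α (k + 2) i j = fold (z (k + 1) j - z k i) (z (k + 2) 0 - z k i)
      (z (k + 2) 1 - z k i) (α (k + 2) i j) := by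
    intro j
    rw [edgeFold, add_two_one, add_two_two]
  have e₂ : ∀ j, edgeFold z α (k + 1) j i = fold (z (k + 2) j - z k i) (z (k + 1) 0 - z k i)
      (z (k + 1) 1 - z k i) (α (k + 1) j i) := by
    intro j
    rw [edgeFold, add_one_one, add_one_two]
    apply fold_congr _ one_pos
    simp only [planeDet, Complex.sub_re, Complex.sub_im]
    ring
  simp only [← e₁, ← e₂] at hX hY hmode
  refine ⟨hR, hX, hY, fun X x₂ x₁ => ?_⟩
  rw [← x₁, ← x₂] at hmode
  rcases hmode with ⟨a, b, c⟩ | ⟨a, b, c⟩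
  · exact Or.inl ⟨a, b, c⟩
  · exact Or.inr ⟨a, b, c⟩

/-- The Dehn invariant vanishes for every realization in space of the edge lengths of a planar
position with concentric circles, provided the vertices `z 1 0`, `z 1 1` are not at the same
distance from the center when another pair is, and the position is symmetric in a line when the two
other pairs are. -/
theorem IsConcentric.dehnInvariant_eq_zero (h : IsConcentric z m R)
    (h₀₁ : ¬ (‖z 0 0‖ = ‖z 0 1‖ ∧ ‖z 1 0‖ = ‖z 1 1‖))
    (h₁₂ : ¬ (‖z 1 0‖ = ‖z 1 1‖ ∧ ‖z 2 0‖ = ‖z 2 1‖))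
    (hsym : ‖z 0 0‖ = ‖z 0 1‖ → ‖z 2 0‖ = ‖z 2 1‖ →
      ((∀ j, ‖z 0 0 - z 1 j‖ = ‖z 0 1 - z 1 j‖) ∧ (∀ j, ‖z 2 0 - z 1 j‖ = ‖z 2 1 - z 1 j‖) ∧
        ‖z 2 0 - z 0 0‖ = ‖z 2 1 - z 0 1‖ ∧ ‖z 2 0 - z 0 1‖ = ‖z 2 1 - z 0 0‖) ∧
      0 < 1 - m 0 / m 1 ∧ 0 < 1 - m 2 / m 1 ∧ 0 < m 0 * m 2)
    {P : Octahedron E3} (hd : ∀ k l i j, k ≠ l → dist (P k i) (P l j) = ‖z k i - z l j‖) {ω : ℤˣ}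
    {α : Fin 3 → Fin 2 → Fin 2 → ℝ} (hα : ∀ k i j, IsDihedralAngle ω P k i j (α k i j))
    {f : ℝ →ₗ[ℚ] ℝ} (hf : f Real.pi = 0) : dehnInvariant f P α = 0 := by
  have V := vertex_dichotomy h hd hα hf
  have hclass : ∀ k i j, edgeFold z α k i j = edgeFold z α k 0 0 := by
    intro k i j
    have a : ∀ i, edgeFold z α k i 0 = edgeFold z α k i 1 := by
      intro i
      have := (V (k + 1) i).2.1
      rwa [add_one_two] at this
    have b : ∀ j, edgeFold z α k 0 j = edgeFold z α k 1 j := by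
      intro j
      have := (V (k + 2) j).2.2.1
      rwa [add_two_one] at this
    fin_cases i <;> fin_cases j <;> simp only [Fin.zero_eta, Fin.mk_one]
    · exact (a 0).symm
    · exact (b 0).symm
    · rw [← a, ← b]
  have hpow : ∀ {a b : ℂ}, ‖a‖ ^ 2 = ‖b‖ ^ 2 → ‖a‖ = ‖b‖ := fun h =>
    (pow_left_inj₀ (norm_nonneg _) (norm_nonneg _) two_ne_zero).1 h
  have hL : ∀ k i j, dist (P (k + 1) i) (P (k + 2) j) = ‖z (k + 1) i - z (k + 2) j‖ := fun k i j =>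
    hd _ _ _ _ (add_two_ne_add_one k).symm
  refine sum_eq_zero_of_modes (R := R) (X := fun k => edgeFold z α k 0 0)
    (L := fun k i j => dist (P (k + 1) i) (P (k + 2) j)) (g := fun k i j => f (α k i j))
    (σ := fun k l => SignType.sign (1 - m l / m k)) (ρ := fun k i => ‖z k i‖ ^ 2)
    (fun k => (h.R_pos k).ne') (fun k => (V k 0).1)
    (fun k i => pow_ne_zero 2 (norm_ne_zero_iff.2 (h.ne_zero k i)))
    (fun k i => (V k i).2.2.2 _ (hclass _ _ _).symm (hclass _ _ _).symm) ?_ ?_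
    (fun h => h₀₁ ⟨hpow h.1, hpow h.2⟩) (fun h => h₁₂ ⟨hpow h.1, hpow h.2⟩) ?_ ?_
  · intro k hk i j
    apply map_eq_zero_of_sin_eq_zero hf
    apply pow_eq_zero_iff two_ne_zero |>.1
    rw [← sin_sq_of_fold (α k i j) (h.face_next k i j 0) (h.face_next k i j 1)]
    rw [← edgeFold, hclass]
    exact hk
  · intro k he
    constructor
    · intro hR
      refine false_of_common_points_of_tangents (h.R_pos (k + 1)) (h.ne k) (h.ne (k + 2)) hR (he.symm.trans hR)
        ?_ ?_ ?_ ?_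
      all_goals
        first
        | (have t := h.touch (k + 1) 0 0
           rw [add_one_one, add_one_two, planeDet_swap, neg_sq, norm_sub_rev] at t; exact t)
        | (have t := h.touch (k + 1) 1 0
           rw [add_one_one, add_one_two, planeDet_swap, neg_sq, norm_sub_rev] at t; exact t)
        | (have t := h.touch (k + 1) 0 1
           rw [add_one_one, add_one_two, planeDet_swap, neg_sq, norm_sub_rev] at t; exact t)
        | (have t := h.touch (k + 1) 1 1
           rw [add_one_one, add_one_two, planeDet_swap, neg_sq, norm_sub_rev] at t; exact t)
    · intro hR
      have t : ∀ i j, planeDet (z k i) (z (k + 1) j) ^ 2 =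
          R (k + 2) * ‖z (k + 1) j - z k i‖ ^ 2 := by
        intro i j
        have t := h.touch (k + 2) i j
        rwa [add_two_one, add_two_two] at t
      exact false_of_common_points_of_tangents (h.R_pos (k + 2)) (h.ne k) (h.ne (k + 1)) hR (he.symm.trans hR)
        (t 0 0) (t 0 1) (t 1 0) (t 1 1)
  · intro k hg hg'
    simp only [hL, norm_sub_rev (z (k + 1) _)]
    have hn := h.vertex_ne_next (k + 1)
    rw [add_one_one] at hn
    exact h.sum_mul_eq_zero hn hg hg'
  · intro e₀ e₂
    obtain ⟨⟨l₂, l₀, l₁, l₁'⟩, s₁₀, s₁₂, s₀₂⟩ := hsym (hpow e₀) (hpow e₂)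
    refine ⟨⟨fun j => ?_, fun i => ?_, ?_, ?_⟩, ?_, ?_, ?_⟩
    · rw [hL, hL]; exact l₂ j
    · rw [hL, hL, norm_sub_rev, norm_sub_rev (z (0 + 1) i)]; exact l₀ i
    · rw [hL, hL]; exact l₁
    · rw [hL, hL]; exact l₁'
    · simp [sign_pos s₁₀]
    · simp [sign_pos s₁₂]
    · have n : 1 - m 2 / m 0 ≠ 0 := h.ratio_ne (fun i j => h.vertex_ne_prev 0 i j)
      have m0 := h.m_ne_zero 0
      have m2 := h.m_ne_zero 2
      have e : 1 - m 0 / m 2 = - ((m 0 * m 2) / m 2 ^ 2 * (1 - m 2 / m 0)) := by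
        field_simp; ring
      have e' : (SignType.sign (1 - m 0 / m 2) : ℝ) = - SignType.sign (1 - m 2 / m 0) := by
        rw [e, Left.sign_neg, sign_mul, sign_pos (show 0 < (m 0 * m 2) / m 2 ^ 2 by positivity),
          one_mul, SignType.coe_neg]
      refine ⟨e', ?_⟩
      show (SignType.sign (1 - m 2 / m 0) : ℝ) * SignType.sign (1 - m 0 / m 2) = -1
      rw [e']
      linear_combination - sign_sq_of_ne_zero n


end Realization

/-! ### The planar position in complex coordinates -/

/-- Two segments `ab` and `cd` of the plane have a common interior point. -/
def SegmentsCross (a b c d : ℂ) : Prop :=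
  ∃ p q r s : ℝ, 0 < p ∧ 0 < q ∧ 0 < r ∧ 0 < s ∧ p + q = 1 ∧ r + s = 1 ∧
    p * a + q * b = r * c + s * d

/-- The conditions on the planar position of a Bricard octahedron of type 3, in complex coordinates
with the common center of the circles as origin: `a`, `b`, `c` are the pairs of opposite vertices,
`T i j` and `U i j` are the points of contact on the lines through `a i` and `b j` and through `a i`
and `c j`. -/
structure IsPlanarPosition (a b c : Fin 2 → ℂ) (T U : Fin 2 → Fin 2 → ℂ) (rC rB : ℝ) : Prop where
  rC_pos : 0 < rC
  rB_pos : 0 < rB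
  rC_ne_rB : rC ≠ rB
  a_ne : a 0 ≠ a 1
  b_ne : b 0 ≠ b 1
  c_ne : c 0 ≠ c 1
  ab_ne : ∀ i j, a i ≠ b j
  ac_ne : ∀ i j, a i ≠ c j
  norm_T : ∀ i j, ‖T i j‖ = rC
  dot_T_a : ∀ i j, planeDot (T i j) (a i) = rC ^ 2
  dot_T_b : ∀ i j, planeDot (T i j) (b j) = rC ^ 2
  mem_T : ∀ i j, ∃ t : ℝ, 0 ≤ t ∧ t ≤ 1 ∧ T i j = (1 - t : ℝ) * a i + t * b j
  norm_U : ∀ i j, ‖U i j‖ = rB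
  dot_U_a : ∀ i j, planeDot (U i j) (a i) = rB ^ 2
  dot_U_c : ∀ i j, planeDot (U i j) (c j) = rB ^ 2
  not_line_ab : ∀ (w : ℂ) (ρ : ℝ), w ≠ 0 →
    ¬ ∀ i, planeDot w (a i) = ρ ∧ planeDot w (b i) = ρ
  not_line_ac : ∀ (w : ℂ) (ρ : ℝ), w ≠ 0 →
    ¬ ∀ i, planeDot w (a i) = ρ ∧ planeDot w (c i) = ρ
  side_ab : ∀ i j, 0 ≤ planeDet (b j - a i) (a (1 - i) - a i) *
    planeDet (b j - a i) (b (1 - j) - a i)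
  cross : SegmentsCross (a 0) (c 0) (a 1) (c 1) ∨ SegmentsCross (c 0) (a 1) (c 1) (a 0)

theorem planeDot_map (Φ : E2 ≃ₗᵢ[ℝ] ℂ) (x y : E2) : planeDot (Φ x) (Φ y) = inner ℝ x y := by
  rw [← Φ.inner_map_map, Complex.inner]
  simp [planeDot]
  ring

theorem planeDet_mul_nonneg_of_wSameSide (Φ : E2 ≃ₗᵢ[ℝ] ℂ) (o : E2) {a b c d : E2}
    (h : line[ℝ, a, b].WSameSide c d) :
    0 ≤ planeDet (Φ (b - o) - Φ (a - o)) (Φ (c - o) - Φ (a - o)) *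
      planeDet (Φ (b - o) - Φ (a - o)) (Φ (d - o) - Φ (a - o)) := by
  obtain ⟨p, hp, q, hq, h⟩ := h
  have key : ∀ {x y : E2}, y ∈ line[ℝ, a, b] →
      planeDet (Φ (b - o) - Φ (a - o)) (Φ (x - o) - Φ (a - o)) =
        planeDet (Φ (b - o) - Φ (a - o)) (Φ (x - y)) := by
    intro x y hy
    rw [← sub_add_cancel y a, ← vadd_eq_add, vadd_left_mem_affineSpan_pair] at hy
    obtain ⟨t, ht⟩ := hy
    have e : x - y = (x - o) - (a - o) - t • ((b - o) - (a - o)) := by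
      rw [vsub_eq_sub] at ht
      rw [sub_sub_sub_cancel_right b a o, ht]; abel
    rw [e]
    simp only [map_sub Φ (x - o - (a - o)), map_sub Φ (x - o) (a - o), map_sub Φ (b - o) (a - o),
      map_smul]
    simp only [planeDet, Complex.sub_re, Complex.sub_im, Complex.real_smul, Complex.mul_re,
      Complex.mul_im, Complex.ofReal_re, Complex.ofReal_im]
    ring
  rw [key hp, key hq]
  generalize Φ (b - o) - Φ (a - o) = w
  have h' : SameRay ℝ (Φ (c - p)) (Φ (d - q)) := h.map Φ.toLinearEquiv.toLinearMap
  rcases h' with h' | h' | ⟨r, s, hr, hs, h'⟩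
  · rw [h']; simp [planeDet]
  · rw [h']; simp [planeDet]
  · have e : Φ (c - p) = (s / r : ℝ) • Φ (d - q) := by
      rw [div_eq_inv_mul, mul_smul, ← h', smul_smul, inv_mul_cancel₀ hr.ne', one_smul]
    have e' : planeDet w (Φ (c - p)) = s / r * planeDet w (Φ (d - q)) := by
      rw [e]
      simp only [planeDet, Complex.real_smul, Complex.mul_re, Complex.mul_im, Complex.ofReal_re,
        Complex.ofReal_im]
      ring
    rw [e', mul_assoc]
    exact mul_nonneg (by positivity) (mul_self_nonneg _)

theorem collinear_of_planeDot (Φ : E2 ≃ₗᵢ[ℝ] ℂ) (o : E2) {a b c d : E2} {w : ℂ} {ρ : ℝ}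
    (hw : w ≠ 0) (ha : planeDot w (Φ (a - o)) = ρ) (hb : planeDot w (Φ (b - o)) = ρ)
    (hc : planeDot w (Φ (c - o)) = ρ) (hd : planeDot w (Φ (d - o)) = ρ) :
    Collinear ℝ {a, b, c, d} := by
  rw [collinear_iff_of_mem (p₀ := a) (by simp)]
  refine ⟨Φ.symm (Complex.I * w), ?_⟩
  have key : ∀ x, planeDot w (Φ (x - o)) = ρ → ∃ r : ℝ, x = r • Φ.symm (Complex.I * w) +ᵥ a := by
    intro x hx
    have hn : w.re ^ 2 + w.im ^ 2 ≠ 0 := by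
      rw [← norm_sq_re_im]; exact pow_ne_zero 2 (norm_ne_zero_iff.2 hw)
    refine ⟨planeDet w (Φ (x - o) - Φ (a - o)) / (w.re ^ 2 + w.im ^ 2), ?_⟩
    have h : planeDot w (Φ (x - o)) = planeDot w (Φ (a - o)) := hx.trans ha.symm
    have e : Φ (x - o) - Φ (a - o) = (planeDet w (Φ (x - o) - Φ (a - o)) /
        (w.re ^ 2 + w.im ^ 2)) • (Complex.I * w) := by
      simp only [planeDot] at h
      generalize Φ (x - o) = y at *
      generalize Φ (a - o) = z at *
      apply Complex.ext <;>
      · simp only [planeDet, Complex.sub_re, Complex.sub_im, Complex.real_smul, Complex.mul_re,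
          Complex.mul_im, Complex.ofReal_re, Complex.ofReal_im, Complex.I_re, Complex.I_im]
        field_simp
        first | linear_combination w.re * h | linear_combination w.im * h
    have e2 : x - a = (planeDet w (Φ (x - o) - Φ (a - o)) /
        (w.re ^ 2 + w.im ^ 2)) • Φ.symm (Complex.I * w) := by
      apply Φ.injective
      rw [map_smul, Φ.apply_symm_apply, ← e, ← map_sub]
      congr 1; abel
    rw [← e2, vadd_eq_add, sub_add_cancel]
  intro p hp
  simp only [Set.mem_insert_iff, Set.mem_singleton_iff] at hp
  rcases hp with rfl | rfl | rfl | rfl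
  · exact key _ ha
  · exact key _ hb
  · exact key _ hc
  · exact key _ hd

theorem segmentsCross_of_nonempty (Φ : E2 ≃ₗᵢ[ℝ] ℂ) (o : E2) {a b c d : E2}
    (h : (openSegment ℝ a b ∩ openSegment ℝ c d).Nonempty) :
    SegmentsCross (Φ (a - o)) (Φ (b - o)) (Φ (c - o)) (Φ (d - o)) := by
  obtain ⟨x, ⟨p, q, hp, hq, hpq, hx⟩, ⟨r, s, hr, hs, hrs, hx'⟩⟩ := h
  refine ⟨p, q, r, s, hp, hq, hr, hs, hpq, hrs, ?_⟩
  have : ∀ {p q : ℝ} {a b : E2}, p + q = 1 → p • a + q • b = x →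
      (p : ℂ) * Φ (a - o) + q * Φ (b - o) = Φ (x - o) := by
    intro p q a b hpq hx
    have e : x - o = p • (a - o) + q • (b - o) := by
      rw [← hx, eq_sub_of_add_eq hpq]; module
    rw [e, map_add, map_smul, map_smul, Complex.real_smul, Complex.real_smul]
  rw [this hpq hx, this hrs hx']

theorem planeDot_of_isTangentAt (Φ : E2 ≃ₗᵢ[ℝ] ℂ) {o x : E2} {r : ℝ} {a b y : E2}
    (h : (EuclideanGeometry.Sphere.mk o r).IsTangentAt x line[ℝ, a, b]) (hy : y ∈ line[ℝ, a, b]) :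
    planeDot (Φ (x - o)) (Φ (y - o)) = r ^ 2 := by
  have h₁ := h.inner_right_eq_zero_of_mem hy
  have h₂ := h.mem_sphere
  rw [EuclideanGeometry.mem_sphere, dist_eq_norm] at h₂
  simp only [vsub_eq_sub] at h₁ h₂
  have e : y - o = (y - x) + (x - o) := by abel
  rw [planeDot_map, e, inner_add_right, h₁, real_inner_self_eq_norm_sq, h₂, zero_add]

theorem IsFlatType3.exists_planarPosition {O : Octahedron E2} (hO : IsFlatType3 O) :
    ∃ (o : E2) (rB rC : ℝ), ∀ Φ : E2 ≃ₗᵢ[ℝ] ℂ, ∃ T U : Fin 2 → Fin 2 → ℂ,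
      IsPlanarPosition (fun i => Φ (O 0 i - o)) (fun i => Φ (O 1 i - o)) (fun i => Φ (O 2 i - o))
        T U rC rB := by
  obtain ⟨o, rB, rC, hB, hC, hne, hconv, hT, hcross, hU⟩ := hO
  refine ⟨o, rB, rC, fun Φ => ?_⟩
  choose x hx hxT using hT
  choose y hy using hU
  have inj : ∀ {u v : E2}, Φ (u - o) = Φ (v - o) → u = v := fun h => by
    simpa using Φ.injective h
  have dab := hconv.distinct
  have dac := hcross.distinct
  have hAB : ∀ i j, O 0 i ≠ O 1 j := by
    intro i j h
    fin_cases i <;> fin_cases j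
    · exact absurd (dab (a₁ := 0) (a₂ := 1) h) (by decide)
    · exact absurd (dab (a₁ := 0) (a₂ := 3) h) (by decide)
    · exact absurd (dab (a₁ := 2) (a₂ := 1) h) (by decide)
    · exact absurd (dab (a₁ := 2) (a₂ := 3) h) (by decide)
  have hAC : ∀ i j, O 0 i ≠ O 2 j := by
    intro i j h
    fin_cases i <;> fin_cases j
    · exact absurd (dac (a₁ := 0) (a₂ := 1) h) (by decide)
    · exact absurd (dac (a₁ := 0) (a₂ := 3) h) (by decide)
    · exact absurd (dac (a₁ := 2) (a₂ := 1) h) (by decide)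
    · exact absurd (dac (a₁ := 2) (a₂ := 3) h) (by decide)
  refine ⟨fun i j => Φ (x i j - o), fun i j => Φ (y i j - o), hC, hB, hne.symm,
    fun h => absurd (dab (a₁ := 0) (a₂ := 2) (inj h)) (by decide),
    fun h => absurd (dab (a₁ := 1) (a₂ := 3) (inj h)) (by decide),
    fun h => absurd (dac (a₁ := 1) (a₂ := 3) (inj h)) (by decide),
    fun i j h => hAB i j (inj h), fun i j h => hAC i j (inj h), ?_, ?_, ?_, ?_, ?_, ?_, ?_, ?_, ?_,
    ?_, ?_⟩
  · intro i j
    rw [Φ.norm_map, ← dist_eq_norm]; exact (hxT i j).mem_sphere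
  · exact fun i j => planeDot_of_isTangentAt Φ (hxT i j) (left_mem_affineSpan_pair _ _ _)
  · exact fun i j => planeDot_of_isTangentAt Φ (hxT i j) (right_mem_affineSpan_pair _ _ _)
  · intro i j
    obtain ⟨s, t, hs, ht, hst, h⟩ := hx i j
    refine ⟨t, ht, by linarith, ?_⟩
    have e : x i j - o = (1 - t) • (O 0 i - o) + t • (O 1 j - o) := by
      rw [← h, eq_sub_of_add_eq hst]; module
    simp only [e, map_add, map_smul, Complex.real_smul]
  · intro i j
    rw [Φ.norm_map, ← dist_eq_norm]; exact (hy i j).mem_sphere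
  · exact fun i j => planeDot_of_isTangentAt Φ (hy i j) (left_mem_affineSpan_pair _ _ _)
  · exact fun i j => planeDot_of_isTangentAt Φ (hy i j) (right_mem_affineSpan_pair _ _ _)
  · intro w ρ hw h
    exact hconv.not_collinear
      (collinear_of_planeDot Φ o hw (h 0).1 (h 0).2 (h 1).1 (h 1).2)
  · intro w ρ hw h
    exact hcross.not_collinear
      (collinear_of_planeDot Φ o hw (h 0).1 (h 0).2 (h 1).1 (h 1).2)
  · -- the line through `b j` and `a i`, traversed in either direction
    have flip : ∀ u v s t : ℂ, 0 ≤ planeDet (u - v) (s - v) * planeDet (u - v) (t - v) →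
        0 ≤ planeDet (v - u) (t - u) * planeDet (v - u) (s - u) := by
      intro u v s t h
      have : planeDet (v - u) (t - u) * planeDet (v - u) (s - u) =
          planeDet (u - v) (s - v) * planeDet (u - v) (t - v) := by
        simp only [planeDet, Complex.sub_re, Complex.sub_im]; ring
      rwa [this]
    intro i j
    fin_cases i <;> fin_cases j
    · exact planeDet_mul_nonneg_of_wSameSide Φ o hconv.side_ab
    · exact flip _ _ _ _ (planeDet_mul_nonneg_of_wSameSide Φ o hconv.side_da)
    · exact flip _ _ _ _ (planeDet_mul_nonneg_of_wSameSide Φ o hconv.side_bc)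
    · exact planeDet_mul_nonneg_of_wSameSide Φ o hconv.side_cd
  · exact hcross.cross.imp (segmentsCross_of_nonempty Φ o) (segmentsCross_of_nonempty Φ o)

/-! ### Quadrilaterals with sides tangent to a circle -/

/-- The points of contact `t₀`, `t₁` of the two tangents from `x` are the roots of the quadratic
equation `conj x * t ^ 2 - 2 * r ^ 2 * t + r ^ 2 * x = 0`. -/
theorem contact_points {t₀ t₁ x : ℂ} {r : ℝ} (h₀ : ‖t₀‖ = r) (h₁ : ‖t₁‖ = r)
    (d₀ : planeDot t₀ x = r ^ 2) (d₁ : planeDot t₁ x = r ^ 2) (h : t₀ = t₁ → x = t₀) :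
    conj x * (t₀ + t₁) = 2 * r ^ 2 ∧ conj x * (t₀ * t₁) = r ^ 2 * x := by
  have norm : ∀ t : ℂ, ‖t‖ = r → t * conj t = r ^ 2 := by
    intro t ht
    rw [Complex.mul_conj, Complex.normSq_eq_norm_sq, ht]; push_cast; rfl
  have dot : ∀ t : ℂ, planeDot t x = r ^ 2 → conj x * t + x * conj t = 2 * r ^ 2 := by
    intro t ht
    apply Complex.ext
    · simp only [planeDot] at ht
      simp [← Complex.ofReal_pow]
      linarith
    · simp [← Complex.ofReal_pow]
      ring
  have n₀ := norm t₀ h₀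
  have n₁ := norm t₁ h₁
  have e₀ := dot t₀ d₀
  have e₁ := dot t₁ d₁
  by_cases ht : t₀ = t₁
  · have hx := h ht
    subst ht
    subst hx
    constructor
    · linear_combination 2 * n₀
    · linear_combination x * n₀
  · have ht' := sub_ne_zero.2 ht
    have q₀ : conj x * t₀ ^ 2 - 2 * r ^ 2 * t₀ + r ^ 2 * x = 0 := by
      linear_combination t₀ * e₀ - x * n₀
    have q₁ : conj x * t₁ ^ 2 - 2 * r ^ 2 * t₁ + r ^ 2 * x = 0 := by
      linear_combination t₁ * e₁ - x * n₁
    have s : conj x * (t₀ + t₁) = 2 * r ^ 2 := by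
      apply mul_left_cancel₀ ht'
      linear_combination q₀ - q₁
    refine ⟨s, ?_⟩
    linear_combination t₀ * s - q₀

theorem ne_zero_of_planeDot {t x : ℂ} {r : ℝ} (hr : 0 < r) (d : planeDot t x = r ^ 2) : x ≠ 0 := by
  rintro rfl
  have : planeDot t 0 = 0 := by simp [planeDot]
  rw [this] at d
  exact (pow_pos hr 2).ne d

/-- In a quadrilateral with sides on tangents of a circle around the origin, the sums and the
products of opposite vertices are in the same real ratio: both pairs of vertices are expressed by
the sum and the product of the four points of contact. -/
theorem exists_ratio {x y : Fin 2 → ℂ} {T : Fin 2 → Fin 2 → ℂ} {r : ℝ} (hr : 0 < r)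
    (hT : ∀ i j, ‖T i j‖ = r) (hx : ∀ i j, planeDot (T i j) (x i) = r ^ 2)
    (hy : ∀ i j, planeDot (T i j) (y j) = r ^ 2) (cx : ∀ i, T i 0 = T i 1 → x i = T i 0)
    (cy : ∀ j, T 0 j = T 1 j → y j = T 0 j) :
    ∃ m : ℝ, m ≠ 0 ∧ y 0 + y 1 = m * (x 0 + x 1) ∧ y 0 * y 1 = m * (x 0 * x 1) := by
  have X := fun i => contact_points (hT i 0) (hT i 1) (hx i 0) (hx i 1) (cx i)
  have Y := fun j => contact_points (hT 0 j) (hT 1 j) (hy 0 j) (hy 1 j) (cy j)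
  have xn : ∀ i, x i ≠ 0 := fun i => ne_zero_of_planeDot hr (hx i 0)
  have yn : ∀ i, y i ≠ 0 := fun i => ne_zero_of_planeDot hr (hy 0 i)
  have hrc : (r : ℂ) ≠ 0 := by exact_mod_cast hr.ne'
  have px : x 0 * x 1 ≠ 0 := mul_ne_zero (xn 0) (xn 1)
  have py : y 0 * y 1 ≠ 0 := mul_ne_zero (yn 0) (yn 1)
  have cpx : conj (x 0 * x 1) ≠ 0 := (map_ne_zero _).2 px
  have cpy : conj (y 0 * y 1) ≠ 0 := (map_ne_zero _).2 py
  have qx : conj (x 0 * x 1) * (T 0 0 * T 0 1 * T 1 0 * T 1 1) = r ^ 4 * (x 0 * x 1) := by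
    rw [map_mul]
    linear_combination conj (x 1) * T 1 0 * T 1 1 * (X 0).2 + r ^ 2 * x 0 * (X 1).2
  have qy : conj (y 0 * y 1) * (T 0 0 * T 0 1 * T 1 0 * T 1 1) = r ^ 4 * (y 0 * y 1) := by
    rw [map_mul]
    linear_combination conj (y 1) * T 0 1 * T 1 1 * (Y 0).2 + r ^ 2 * y 0 * (Y 1).2
  have sx : conj (x 0 * x 1) * (T 0 0 + T 0 1 + T 1 0 + T 1 1) = 2 * r ^ 2 * conj (x 0 + x 1) := by
    rw [map_mul, map_add]
    linear_combination conj (x 1) * (X 0).1 + conj (x 0) * (X 1).1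
  have sy : conj (y 0 * y 1) * (T 0 0 + T 0 1 + T 1 0 + T 1 1) = 2 * r ^ 2 * conj (y 0 + y 1) := by
    rw [map_mul, map_add]
    linear_combination conj (y 1) * (Y 0).1 + conj (y 0) * (Y 1).1
  have real : conj (y 0 * y 1) * (x 0 * x 1) = conj (x 0 * x 1) * (y 0 * y 1) := by
    apply mul_left_cancel₀ (pow_ne_zero 4 hrc)
    linear_combination conj (x 0 * x 1) * qy - conj (y 0 * y 1) * qx
  have sum : conj (y 0 * y 1) * conj (x 0 + x 1) = conj (x 0 * x 1) * conj (y 0 + y 1) := by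
    apply mul_left_cancel₀ (mul_ne_zero two_ne_zero (pow_ne_zero 2 hrc))
    linear_combination conj (x 0 * x 1) * sy - conj (y 0 * y 1) * sx
  have hm : (((y 0 * y 1 / (x 0 * x 1)).re : ℝ) : ℂ) = y 0 * y 1 / (x 0 * x 1) := by
    apply Complex.conj_eq_iff_re.1
    rw [map_div₀, div_eq_div_iff cpx px, real]; ring
  have sum' := congrArg conj sum
  simp only [map_mul conj (conj _), Complex.conj_conj] at sum'
  refine ⟨(y 0 * y 1 / (x 0 * x 1)).re, ?_, ?_, ?_⟩
  · intro h
    rw [h, Complex.ofReal_zero] at hm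
    exact (div_ne_zero py px) hm.symm
  · rw [hm]
    rw [div_mul_eq_mul_div, eq_div_iff px]
    linear_combination - sum'
  · rw [hm, div_mul_cancel₀ _ px]

theorem touch_of_planeDot {t x y : ℂ} {r : ℝ} (hr : 0 < r) (ht : ‖t‖ = r)
    (hx : planeDot t x = r ^ 2) (hy : planeDot t y = r ^ 2) :
    planeDet x y ^ 2 = r ^ 2 * ‖y - x‖ ^ 2 := by
  have hn := norm_sq_re_im t
  rw [ht] at hn
  have e : r ^ 2 * planeDet x y = r ^ 2 * planeDet t (y - x) := by
    simp only [planeDot] at hx hy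
    simp only [planeDet, Complex.sub_re, Complex.sub_im]
    linear_combination (x.re * y.im - x.im * y.re) * hn + (t.re * y.im - t.im * y.re) * hx -
      (t.re * x.im - t.im * x.re) * hy
  rw [mul_left_cancel₀ (pow_pos hr 2).ne' e, norm_sq_re_im, hn]
  simp only [planeDot] at hx hy
  simp only [planeDet, Complex.sub_re, Complex.sub_im]
  linear_combination - (t.re * (y.re - x.re) + t.im * (y.im - x.im)) * (hy - hx)

/-- If two consecutive sides `ab`, `ad` of a convex quadrilateral `abcd` touch a circle in the same
point `t`, then this point is `a`, which lies between `b` and `d`. -/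
theorem eq_of_contact_eq {a b c d t : ℂ} {r u v : ℝ} (hr : 0 < r) (ht : ‖t‖ = r)
    (ha : planeDot t a = r ^ 2) (hb : planeDot t b = r ^ 2) (hd : planeDot t d = r ^ 2)
    (hc : planeDot t c ≠ r ^ 2) (hbd : b ≠ d) (hu : 0 ≤ u) (hv : 0 ≤ v)
    (htu : t = (1 - u : ℝ) * a + u * b) (htv : t = (1 - v : ℝ) * a + v * d)
    (h₁ : 0 ≤ planeDet (b - c) (a - c) * planeDet (b - c) (d - c))
    (h₂ : 0 ≤ planeDet (d - c) (a - c) * planeDet (d - c) (b - c)) : a = t := by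
  have hn := norm_sq_re_im t
  rw [ht] at hn
  have hr2 : r ^ 2 ≠ 0 := (pow_pos hr 2).ne'
  have htn : t ≠ 0 := by
    rintro rfl; rw [norm_zero] at ht; exact hr.ne ht
  have hh : 0 < (planeDot t c - r ^ 2) ^ 2 := by
    have := sub_ne_zero.2 hc; positivity
  -- the common tangent has coordinate `planeDet t`, with `a`, `b`, `d` at `α`, `β`, `δ`
  set α := planeDet t a with hα
  set β := planeDet t b with hβ
  set δ := planeDet t d with hδ
  have coord : ∀ x y : ℂ, planeDot t x = r ^ 2 → planeDot t y = r ^ 2 →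
      r ^ 2 * planeDet (x - c) (y - c) = - (planeDot t c - r ^ 2) * (planeDet t y - planeDet t x) := by
    intro x y hx hy
    simp only [planeDot] at hx hy
    simp only [planeDot, planeDet, Complex.sub_re, Complex.sub_im]
    rw [hn] at *
    linear_combination (t.re * (y.im - c.im) - t.im * (y.re - c.re)) * hx - (t.re * (x.im - c.im) - t.im * (x.re - c.re)) * hy
  have inj : ∀ x y : ℂ, planeDot t x = r ^ 2 → planeDot t y = r ^ 2 → planeDet t x = planeDet t y →
      x = y := by
    intro x y hx hy hxy
    have hp : planeDot t x = planeDot t y := hx.trans hy.symm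
    simp only [planeDot] at hp
    simp only [planeDet] at hxy
    rw [hn] at hr2
    apply Complex.ext
    · apply mul_left_cancel₀ hr2
      linear_combination t.re * hp - t.im * hxy
    · apply mul_left_cancel₀ hr2
      linear_combination t.im * hp + t.re * hxy
  have s₁ : 0 ≤ (α - β) * (δ - β) := by
    have e : (planeDot t c - r ^ 2) ^ 2 * ((α - β) * (δ - β)) =
        r ^ 2 * r ^ 2 * (planeDet (b - c) (a - c) * planeDet (b - c) (d - c)) := by
      rw [mul_mul_mul_comm, coord b a hb ha, coord b d hb hd]; ring
    refine nonneg_of_mul_nonneg_right ?_ hh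
    rw [e]; exact mul_nonneg (by positivity) h₁
  have s₂ : 0 ≤ (α - δ) * (β - δ) := by
    have e : (planeDot t c - r ^ 2) ^ 2 * ((α - δ) * (β - δ)) =
        r ^ 2 * r ^ 2 * (planeDet (d - c) (a - c) * planeDet (d - c) (b - c)) := by
      rw [mul_mul_mul_comm, coord d a hd ha, coord d b hd hb]; ring
    refine nonneg_of_mul_nonneg_right ?_ hh
    rw [e]; exact mul_nonneg (by positivity) h₂
  have hβδ : β ≠ δ := fun h => hbd (inj b d hb hd h)
  have lin : ∀ (w : ℝ) (x : ℂ), t = (1 - w : ℝ) * a + w * x → α + w * (planeDet t x - α) = 0 := by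
    intro w x hx
    have : planeDet t t = 0 := by simp only [planeDet]; ring
    have e : planeDet t ((1 - w : ℝ) * a + w * x) = α + w * (planeDet t x - α) := by
      simp only [hα, planeDet, Complex.add_re, Complex.add_im, Complex.mul_re, Complex.mul_im,
        Complex.ofReal_re, Complex.ofReal_im]; ring
    rw [← e, ← hx, this]
  have lu := lin u b htu
  have lv := lin v d htv
  have htt : planeDot t t = r ^ 2 := by rw [hn]; simp only [planeDot]; ring
  have hle : (β - α) * (δ - α) ≤ 0 := by
    by_contra hpos
    push Not at hpos
    -- otherwise `b` and `d` are on the same side of `a`, each at least as far as the other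
    have e : 0 < (β - δ) ^ 2 := by have := sub_ne_zero.2 hβδ; positivity
    have c₁ : (α - β) * (δ - β) + (α - δ) * (β - δ) = (β - δ) ^ 2 := by ring
    rcases lt_or_gt_of_ne (left_ne_zero_of_mul hpos.ne') with h | h
    · have h' : δ - α < 0 := by
        by_contra h'; push Not at h'
        exact absurd hpos (not_lt.2 (mul_nonpos_of_nonpos_of_nonneg h.le h'))
      have k₁ : 0 ≥ δ - β := by
        by_contra k; push Not at k
        nlinarith [mul_pos_of_neg_of_neg h (show -(δ - β) < 0 by linarith), mul_pos (show 0 < α - δ by linarith) k]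
      have k₂ : 0 ≥ β - δ := by
        by_contra k; push Not at k
        nlinarith [mul_pos (show 0 < α - β by linarith) k]
      exact hβδ (by linarith)
    · have h' : 0 < δ - α := by
        by_contra h'; push Not at h'
        exact absurd hpos (not_lt.2 (mul_nonpos_of_nonneg_of_nonpos h.le h'))
      have k₁ : 0 ≤ δ - β := by
        by_contra k; push Not at k
        nlinarith [mul_pos h' (show 0 < β - δ by linarith)]
      have k₂ : 0 ≤ β - δ := by
        by_contra k; push Not at k
        nlinarith [mul_pos h (show 0 < δ - β by linarith)]
      exact hβδ (by linarith)
  have hα0 : α = 0 := by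
    have e : α ^ 2 = u * v * ((β - α) * (δ - α)) := by
      linear_combination α * lu - u * (β - α) * lv
    have : α ^ 2 ≤ 0 := by
      rw [e]; exact mul_nonpos_of_nonneg_of_nonpos (mul_nonneg hu hv) hle
    exact pow_eq_zero_iff two_ne_zero |>.1 (le_antisymm this (sq_nonneg _))
  refine inj a t ha htt ?_
  rw [← hα, hα0]; simp only [planeDet]; ring

theorem eq_one_sub_of_ne {k i : Fin 2} (h : k ≠ i) : k = 1 - i := by revert k i; decide

theorem SegmentsCross.exists_relation {a b c d : ℂ} (h : SegmentsCross a b c d) :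
    ∃ p q r s : ℝ, p * r < 0 ∧ q * s < 0 ∧ p + q + r + s = 0 ∧
      (p * a + q * b + r * c + s * d : ℂ) = 0 := by
  obtain ⟨p, q, r, s, hp, hq, hr, hs, hpq, hrs, h⟩ := h
  refine ⟨p, q, -r, -s, by nlinarith [mul_pos hp hr], by nlinarith [mul_pos hq hs], by linarith, ?_⟩
  push_cast
  linear_combination h

namespace IsPlanarPosition

variable {a b c : Fin 2 → ℂ} {T U : Fin 2 → Fin 2 → ℂ} {rC rB : ℝ}

/-- Crossing of two opposite sides, whichever these are, gives an affine relation between the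
vertices in which opposite vertices have coefficients of opposite signs. -/
theorem exists_relation (h : IsPlanarPosition a b c T U rC rB) :
    ∃ p₀ p₁ q₀ q₁ : ℝ, p₀ * p₁ < 0 ∧ q₀ * q₁ < 0 ∧ p₀ + p₁ + q₀ + q₁ = 0 ∧
      (p₀ * a 0 + p₁ * a 1 + q₀ * c 0 + q₁ * c 1 : ℂ) = 0 := by
  rcases h.cross with h | h
  · obtain ⟨p, q, r, s, h₁, h₂, h₃, h₄⟩ := h.exists_relation
    exact ⟨p, r, q, s, h₁, h₂, by linarith, by linear_combination h₄⟩
  · obtain ⟨p, q, r, s, h₁, h₂, h₃, h₄⟩ := h.exists_relation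
    exact ⟨s, q, p, r, by linarith, h₁, by linarith, by linear_combination h₄⟩

theorem contact_a (h : IsPlanarPosition a b c T U rC rB) (i : Fin 2) (hT : T i 0 = T i 1) :
    a i = T i 0 := by
  obtain ⟨u, hu, -, hu'⟩ := h.mem_T i 0
  obtain ⟨v, hv, -, hv'⟩ := h.mem_T i 1
  rw [← hT] at hv'
  have d₁ := h.dot_T_b i 1
  rw [← hT] at d₁
  have ht : T i 0 ≠ 0 := by
    intro h0; have := h.norm_T i 0; rw [h0, norm_zero] at this; exact h.rC_pos.ne this
  have ii : (1 : Fin 2) - (1 - i) = i := by fin_cases i <;> rfl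
  have s₀ := h.side_ab (1 - i) 0
  have s₁ := h.side_ab (1 - i) 1
  rw [ii] at s₀ s₁
  refine eq_of_contact_eq h.rC_pos (h.norm_T i 0) (h.dot_T_a i 0) (h.dot_T_b i 0) d₁ ?_
    h.b_ne hu hv hu' hv' s₀ s₁
  intro hc
  apply h.not_line_ab (T i 0) (rC ^ 2) ht
  refine fun k => ⟨?_, ?_⟩
  · rcases eq_or_ne k i with rfl | hk
    · exact h.dot_T_a _ _
    · rw [eq_one_sub_of_ne hk]; exact hc
  · fin_cases k
    · exact h.dot_T_b _ _
    · exact d₁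

theorem contact_b (h : IsPlanarPosition a b c T U rC rB) (j : Fin 2) (hT : T 0 j = T 1 j) :
    b j = T 0 j := by
  obtain ⟨u, -, hu, hu'⟩ := h.mem_T 0 j
  obtain ⟨v, -, hv, hv'⟩ := h.mem_T 1 j
  rw [← hT] at hv'
  have d₁ := h.dot_T_a 1 j
  rw [← hT] at d₁
  have ht : T 0 j ≠ 0 := by
    intro h0; have := h.norm_T 0 j; rw [h0, norm_zero] at this; exact h.rC_pos.ne this
  have jj : (1 : Fin 2) - (1 - j) = j := by fin_cases j <;> rfl
  have s₀ := h.side_ab 0 (1 - j)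
  have s₁ := h.side_ab 1 (1 - j)
  rw [jj] at s₀ s₁
  have flip : ∀ x y s t : ℂ, 0 ≤ planeDet (x - y) (s - y) * planeDet (x - y) (t - y) →
      0 ≤ planeDet (y - x) (t - x) * planeDet (y - x) (s - x) := by
    intro x y s t h
    have : planeDet (y - x) (t - x) * planeDet (y - x) (s - x) =
        planeDet (x - y) (s - y) * planeDet (x - y) (t - y) := by
      simp only [planeDet, Complex.sub_re, Complex.sub_im]; ring
    rwa [this]
  refine eq_of_contact_eq (u := 1 - u) (v := 1 - v) h.rC_pos (h.norm_T 0 j) (h.dot_T_b 0 j)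
    (h.dot_T_a 0 j) d₁ ?_ h.a_ne (by linarith) (by linarith) (by rw [hu']; push_cast; ring)
    (by rw [hv']; push_cast; ring) (flip _ _ _ _ s₀) (flip _ _ _ _ s₁)
  intro hc
  apply h.not_line_ab (T 0 j) (rC ^ 2) ht
  refine fun k => ⟨?_, ?_⟩
  · fin_cases k
    · exact h.dot_T_a _ _
    · exact d₁
  · rcases eq_or_ne k j with rfl | hk
    · exact h.dot_T_b _ _
    · rw [eq_one_sub_of_ne hk]; exact hc

/-- No three vertices of the crossed quadrilateral are collinear. -/
theorem false_of_three_on_line (h : IsPlanarPosition a b c T U rC rB) {w : ℂ} {ρ : ℝ} (hw : w ≠ 0)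
    (h₃ : (planeDot w (a 0) = ρ ∧ planeDot w (a 1) = ρ ∧
        (planeDot w (c 0) = ρ ∨ planeDot w (c 1) = ρ)) ∨
      (planeDot w (c 0) = ρ ∧ planeDot w (c 1) = ρ ∧
        (planeDot w (a 0) = ρ ∨ planeDot w (a 1) = ρ))) : False := by
  obtain ⟨p₀, p₁, q₀, q₁, hp, hq, hs, hr⟩ := h.exists_relation
  have hre := congrArg Complex.re hr
  have him := congrArg Complex.im hr
  simp only [Complex.add_re, Complex.add_im, Complex.mul_re, Complex.mul_im, Complex.ofReal_re,
    Complex.ofReal_im, Complex.zero_re, Complex.zero_im] at hre him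
  have key : p₀ * (planeDot w (a 0) - ρ) + p₁ * (planeDot w (a 1) - ρ) +
      q₀ * (planeDot w (c 0) - ρ) + q₁ * (planeDot w (c 1) - ρ) = 0 := by
    simp only [planeDot]
    linear_combination w.re * hre + w.im * him - ρ * hs
  have hp₀ : p₀ ≠ 0 := left_ne_zero_of_mul hp.ne
  have hp₁ : p₁ ≠ 0 := right_ne_zero_of_mul hp.ne
  have hq₀ : q₀ ≠ 0 := left_ne_zero_of_mul hq.ne
  have hq₁ : q₁ ≠ 0 := right_ne_zero_of_mul hq.ne
  have last : ∀ {x y : ℝ}, x ≠ 0 → x * (y - ρ) = 0 → y = ρ := fun hx h =>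
    sub_eq_zero.1 ((mul_eq_zero.1 h).resolve_left hx)
  have all : planeDot w (a 0) = ρ ∧ planeDot w (a 1) = ρ ∧ planeDot w (c 0) = ρ ∧
      planeDot w (c 1) = ρ := by
    rcases h₃ with ⟨e₁, e₂, e₃ | e₃⟩ | ⟨e₁, e₂, e₃ | e₃⟩
    · refine ⟨e₁, e₂, e₃, last hq₁ ?_⟩
      rw [e₁, e₂, e₃] at key; linarith
    · refine ⟨e₁, e₂, last hq₀ ?_, e₃⟩
      rw [e₁, e₂, e₃] at key; linarith
    · refine ⟨e₃, last hp₁ ?_, e₁, e₂⟩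
      rw [e₁, e₂, e₃] at key; linarith
    · refine ⟨last hp₀ ?_, e₃, e₁, e₂⟩
      rw [e₁, e₂, e₃] at key; linarith
  exact h.not_line_ac w ρ hw (Fin.forall_fin_two.2 ⟨⟨all.1, all.2.2.1⟩, ⟨all.2.1, all.2.2.2⟩⟩)

theorem U_ne_zero (h : IsPlanarPosition a b c T U rC rB) (i j : Fin 2) : U i j ≠ 0 := by
  intro h0; have := h.norm_U i j; rw [h0, norm_zero] at this; exact h.rB_pos.ne this

theorem U_ne_of_a (h : IsPlanarPosition a b c T U rC rB) (i : Fin 2) : U i 0 ≠ U i 1 := by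
  intro e
  have d₀ := h.dot_U_a i 0
  have d₁ := h.dot_U_c i 0
  have d₂ := h.dot_U_c i 1
  rw [← e] at d₂
  refine h.false_of_three_on_line (h.U_ne_zero i 0) (Or.inr ⟨d₁, d₂, ?_⟩)
  fin_cases i
  · exact Or.inl d₀
  · exact Or.inr d₀

theorem U_ne_of_c (h : IsPlanarPosition a b c T U rC rB) (j : Fin 2) : U 0 j ≠ U 1 j := by
  intro e
  have d₀ := h.dot_U_c 0 j
  have d₁ := h.dot_U_a 0 j
  have d₂ := h.dot_U_a 1 j
  rw [← e] at d₂
  refine h.false_of_three_on_line (h.U_ne_zero 0 j) (Or.inl ⟨d₁, d₂, ?_⟩)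
  fin_cases j
  · exact Or.inl d₀
  · exact Or.inr d₀

theorem exists_ratio_b (h : IsPlanarPosition a b c T U rC rB) :
    ∃ m : ℝ, m ≠ 0 ∧ b 0 + b 1 = m * (a 0 + a 1) ∧ b 0 * b 1 = m * (a 0 * a 1) :=
  exists_ratio h.rC_pos h.norm_T h.dot_T_a h.dot_T_b h.contact_a h.contact_b

theorem exists_ratio_c (h : IsPlanarPosition a b c T U rC rB) :
    ∃ m : ℝ, m ≠ 0 ∧ c 0 + c 1 = m * (a 0 + a 1) ∧ c 0 * c 1 = m * (a 0 * a 1) :=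
  exists_ratio h.rB_pos h.norm_U h.dot_U_a h.dot_U_c (fun i e => (h.U_ne_of_a i e).elim)
    (fun j e => (h.U_ne_of_c j e).elim)

theorem touch_ab (h : IsPlanarPosition a b c T U rC rB) (i j : Fin 2) :
    planeDet (a i) (b j) ^ 2 = rC ^ 2 * ‖b j - a i‖ ^ 2 :=
  touch_of_planeDot h.rC_pos (h.norm_T i j) (h.dot_T_a i j) (h.dot_T_b i j)

theorem touch_ac (h : IsPlanarPosition a b c T U rC rB) (i j : Fin 2) :
    planeDet (a i) (c j) ^ 2 = rB ^ 2 * ‖c j - a i‖ ^ 2 :=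
  touch_of_planeDot h.rB_pos (h.norm_U i j) (h.dot_U_a i j) (h.dot_U_c i j)

/-- The lines through `a i` and `b j` and through `a i` and `c l` have different distances from the
center, so the faces are not degenerate. -/
theorem face_ne_zero (h : IsPlanarPosition a b c T U rC rB) (i j l : Fin 2) :
    planeDet (b j - a i) (c l - a i) ≠ 0 := by
  intro h0
  have hab := h.touch_ab i j
  have hac := h.touch_ac i l
  rw [← planeDet_sub_self] at hab hac
  have hb : ‖b j - a i‖ ^ 2 ≠ 0 :=
    pow_ne_zero 2 (norm_ne_zero_iff.2 (sub_ne_zero.2 (h.ab_ne i j).symm))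
  have hc : ‖c l - a i‖ ^ 2 ≠ 0 :=
    pow_ne_zero 2 (norm_ne_zero_iff.2 (sub_ne_zero.2 (h.ac_ne i l).symm))
  have hne : rC ^ 2 ≠ rB ^ 2 := fun e =>
    h.rC_ne_rB ((pow_left_inj₀ h.rC_pos.le h.rB_pos.le two_ne_zero).1 e)
  apply hne
  apply mul_right_cancel₀ (mul_ne_zero hb hc)
  have e : planeDet (a i) (b j - a i) ^ 2 * ‖c l - a i‖ ^ 2 =
      planeDet (a i) (c l - a i) ^ 2 * ‖b j - a i‖ ^ 2 := by
    rw [norm_sq_re_im, norm_sq_re_im]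
    generalize b j - a i = x at *
    generalize c l - a i = y at *
    generalize a i = v at *
    simp only [planeDet] at h0 ⊢
    linear_combination ((v.im ^ 2 - v.re ^ 2) * (x.re * y.im + x.im * y.re) +
      2 * v.re * v.im * (x.re * y.re - x.im * y.im)) * h0
  linear_combination - ‖c l - a i‖ ^ 2 * hab + ‖b j - a i‖ ^ 2 * hac + e

end IsPlanarPosition

/-! ### Pairs of vertices at the same distance from the center -/

theorem conj_of_norm_eq {x y : ℂ} {s : ℝ} (hs : s ≠ 0) (h : x + y = s) (hn : ‖x‖ = ‖y‖) :
    y = conj x := by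
  have hre := congrArg Complex.re h
  have him := congrArg Complex.im h
  simp only [Complex.add_re, Complex.add_im, Complex.ofReal_re, Complex.ofReal_im] at hre him
  have hn' : ‖x‖ ^ 2 = ‖y‖ ^ 2 := by rw [hn]
  rw [norm_sq_re_im, norm_sq_re_im] at hn'
  have e : s * (x.re - y.re) = 0 := by
    linear_combination hn' - (x.re - y.re) * hre - (x.im - y.im) * him
  have := (mul_eq_zero.1 e).resolve_left hs
  apply Complex.ext
  · simp; linarith
  · simp; linarith

theorem real_or_conj {x y : ℂ} (h : (x + y).im = 0) (h' : (x * y).im = 0) :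
    (x.im = 0 ∧ y.im = 0) ∨ y = conj x := by
  simp only [Complex.add_im, Complex.mul_im] at h h'
  have hy : y.im = - x.im := by linarith
  have e : x.im * (y.re - x.re) = 0 := by rw [hy] at h'; linarith
  rcases mul_eq_zero.1 e with e | e
  · exact Or.inl ⟨e, by rw [hy, e, neg_zero]⟩
  · right
    apply Complex.ext
    · simp; linarith
    · simp [hy]

theorem im_ne_zero_of_conj {x y : ℂ} (h : x ≠ y) (hy : y = conj x) : x.im ≠ 0 := by
  intro h0
  apply h
  rw [hy]
  apply Complex.ext <;> simp [h0]

theorem norm_sub_of_conj {x y w : ℂ} (hy : y = conj x) (hw : w.im = 0) : ‖x - w‖ = ‖y - w‖ := by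
  have : y - w = conj (x - w) := by
    rw [map_sub, hy, Complex.conj_eq_iff_im.2 hw]
  rw [this, Complex.norm_conj]

/-- Points on mirror images of a line through the center are at equal distances from it. -/
theorem planeDet_sq_mirror {v x y : ℂ} {l : ℝ} (hv : v ≠ 0) (hl : l ≠ 0)
    (h : (x - v) * (y - v) = l * v ^ 2) :
    planeDet v x ^ 2 / ‖x - v‖ ^ 2 = planeDet v y ^ 2 / ‖y - v‖ ^ 2 := by
  obtain ⟨a₀, a₁, c, s, ha₀, ha₁, hcs, ha, hw₀, hw₁⟩ := exists_mirror_form hv hl h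
  have hr : ‖v‖ ≠ 0 := norm_ne_zero_iff.2 hv
  have hr2 := norm_sq_re_im v
  have key : ∀ (a t : ℝ) (w : ℂ), a ≠ 0 → c ^ 2 + t ^ 2 = 1 →
      w - v = (a / ‖v‖ : ℝ) * v * (c + t * Complex.I) →
      planeDet v w ^ 2 / ‖w - v‖ ^ 2 = ‖v‖ ^ 2 * t ^ 2 := by
    intro a t w ha ht hw
    have hn : ‖w - v‖ ^ 2 = a ^ 2 := by
      have := norm_sq_re_im (c + t * Complex.I : ℂ)
      simp [ht] at this
      rw [hw, norm_mul, norm_mul, Complex.norm_real, Real.norm_eq_abs, abs_div,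
        abs_of_nonneg (norm_nonneg v), div_mul_cancel₀ _ hr, mul_pow, sq_abs]
      rcases this with e | e <;> rw [e] <;> ring
    have hd : planeDet v w = ‖v‖ * a * t := by
      rw [← planeDet_sub_self, hw]
      simp only [planeDet, Complex.mul_re, Complex.mul_im, Complex.add_re, Complex.add_im,
        Complex.ofReal_re, Complex.ofReal_im, Complex.I_re, Complex.I_im]
      field_simp
      rw [hr2]; ring
    rw [hn, hd, div_eq_iff (pow_ne_zero 2 ha)]; ring
  have e : (c - s * Complex.I : ℂ) = c + (-s : ℝ) * Complex.I := by push_cast; ring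
  rw [e] at hw₁
  rw [key a₀ s x ha₀ hcs hw₀, key a₁ (-s) y ha₁ (by rw [neg_sq, hcs]) hw₁, neg_sq]

namespace IsPlanarPosition

variable {a b c : Fin 2 → ℂ} {T U : Fin 2 → Fin 2 → ℂ} {rC rB : ℝ}

theorem bc_ne (h : IsPlanarPosition a b c T U rC rB) (i j : Fin 2) : b i ≠ c j := by
  intro e
  apply h.face_ne_zero 0 i j
  rw [e]; simp only [planeDet]; ring

theorem a_ne_zero (h : IsPlanarPosition a b c T U rC rB) (i : Fin 2) : a i ≠ 0 :=
  ne_zero_of_planeDot h.rC_pos (h.dot_T_a i 0)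

theorem b_ne_zero (h : IsPlanarPosition a b c T U rC rB) (i : Fin 2) : b i ≠ 0 :=
  ne_zero_of_planeDot h.rC_pos (h.dot_T_b 0 i)

theorem c_ne_zero (h : IsPlanarPosition a b c T U rC rB) (i : Fin 2) : c i ≠ 0 :=
  ne_zero_of_planeDot h.rB_pos (h.dot_U_c 0 i)

/-- The crossed quadrilateral is not a parallelogram around the center. -/
theorem a_add_ne_zero (h : IsPlanarPosition a b c T U rC rB) : a 0 + a 1 ≠ 0 := by
  intro h0
  obtain ⟨m, -, hm, -⟩ := h.exists_ratio_c
  rw [h0, mul_zero] at hm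
  obtain ⟨p₀, p₁, q₀, q₁, hp, -, -, hr⟩ := h.exists_relation
  have hr' : ((p₀ - p₁ : ℝ) : ℂ) * a 0 + (q₀ - q₁ : ℝ) * c 0 = 0 := by
    push_cast
    linear_combination hr - p₁ * h0 - q₁ * hm
  have hd : planeDet (a 0) (c 0) ≠ 0 := by
    intro e
    have := h.touch_ac 0 0
    rw [e] at this
    have hn := norm_pos_iff.2 (sub_ne_zero.2 (h.ac_ne 0 0).symm)
    have hB := h.rB_pos
    have : 0 < rB ^ 2 * ‖c 0 - a 0‖ ^ 2 := by positivity
    linarith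
  have hre := congrArg Complex.re hr'
  have him := congrArg Complex.im hr'
  simp only [Complex.add_re, Complex.add_im, Complex.mul_re, Complex.mul_im, Complex.ofReal_re,
    Complex.ofReal_im, Complex.zero_re, Complex.zero_im] at hre him
  have e : (p₀ - p₁) * planeDet (a 0) (c 0) = 0 := by
    simp only [planeDet]
    linear_combination (c 0).im * hre - (c 0).re * him
  have := (mul_eq_zero.1 e).resolve_right hd
  have hpp : p₀ = p₁ := by linarith
  rw [hpp] at hp
  nlinarith [mul_self_nonneg p₁]

/-- A convex quadrilateral does not have opposite vertices which are all mirror images in the same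
line. -/
theorem false_of_conj_ab (h : IsPlanarPosition a b c T U rC rB) {s m : ℝ} (hs : s ≠ 0)
    (ha : a 0 + a 1 = s) (hb : b 0 + b 1 = m * (a 0 + a 1)) (hb' : b 0 * b 1 = m * (a 0 * a 1))
    (ca : a 1 = conj (a 0)) (cb : b 1 = conj (b 0)) : False := by
  have ia := im_ne_zero_of_conj h.a_ne ca
  have ib := im_ne_zero_of_conj h.b_ne cb
  have s₀ := h.side_ab 0 0
  have s₁ := h.side_ab 0 1
  simp only [sub_zero, sub_self] at s₀ s₁
  rw [ca, cb] at s₀ s₁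
  simp only [planeDet, Complex.sub_re, Complex.sub_im, Complex.conj_re, Complex.conj_im] at s₀ s₁
  have e : (a 0).im * (b 0).im * ((b 0).re - (a 0).re) ^ 2 = 0 := by
    apply le_antisymm <;> linarith
  have hre : (b 0).re = (a 0).re := by
    have := (mul_eq_zero.1 e).resolve_left (mul_ne_zero ia ib)
    have := pow_eq_zero_iff two_ne_zero |>.1 this
    linarith
  -- equal sums of the two pairs make the quadratic equations for them equal
  have hm : m = 1 := by
    have h₁ := congrArg Complex.re hb
    have h₂ := congrArg Complex.re ha
    rw [ha, ← Complex.ofReal_mul] at h₁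
    rw [ca] at h₂
    rw [cb] at h₁
    simp only [Complex.add_re, Complex.conj_re, Complex.ofReal_re] at h₁ h₂
    apply mul_right_cancel₀ hs
    rw [one_mul, ← h₁, ← h₂, hre]
  rw [hm, Complex.ofReal_one, one_mul] at hb hb'
  have : (b 0 - a 0) * (b 0 - a 1) = 0 := by
    linear_combination b 0 * hb - hb'
  rcases mul_eq_zero.1 this with e | e
  · exact h.ab_ne 0 0 (sub_eq_zero.1 e).symm
  · exact h.ab_ne 1 0 (sub_eq_zero.1 e).symm

theorem false_of_real_conj (h : IsPlanarPosition a b c T U rC rB) (ha : ∀ i, (a i).im = 0)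
    (hc : c 1 = conj (c 0)) : False := by
  obtain ⟨p₀, p₁, q₀, q₁, -, hq, -, hr⟩ := h.exists_relation
  have ic := im_ne_zero_of_conj h.c_ne hc
  have him := congrArg Complex.im hr
  rw [hc] at him
  simp only [Complex.add_im, Complex.mul_im, Complex.ofReal_re, Complex.ofReal_im,
    Complex.zero_im, ha, Complex.conj_im] at him
  have e : (q₀ - q₁) * (c 0).im = 0 := by linarith
  have hqq : q₀ = q₁ := by
    have := (mul_eq_zero.1 e).resolve_right ic; linarith
  rw [hqq] at hq
  nlinarith [mul_self_nonneg q₁]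

theorem false_of_conj_real (h : IsPlanarPosition a b c T U rC rB) (ha : a 1 = conj (a 0))
    (hc : ∀ i, (c i).im = 0) : False := by
  obtain ⟨p₀, p₁, q₀, q₁, hp, -, -, hr⟩ := h.exists_relation
  have ia := im_ne_zero_of_conj h.a_ne ha
  have him := congrArg Complex.im hr
  rw [ha] at him
  simp only [Complex.add_im, Complex.mul_im, Complex.ofReal_re, Complex.ofReal_im,
    Complex.zero_im, hc, Complex.conj_im] at him
  have e : (p₀ - p₁) * (a 0).im = 0 := by linarith
  have hpp : p₀ = p₁ := by
    have := (mul_eq_zero.1 e).resolve_right ia; linarith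
  rw [hpp] at hp
  nlinarith [mul_self_nonneg p₁]

theorem im_mul_of_conj {x y : ℂ} (h : y = conj x) : (x * y).im = 0 := by
  rw [h, Complex.mul_conj, Complex.ofReal_im]

/-- The line through `b 0` and `c 0` does not contain the center. -/
theorem planeDet_bc_ne_zero (h : IsPlanarPosition a b c T U rC rB) {s m n : ℝ} (hs : s ≠ 0)
    (hm : m ≠ 0) (hn : n ≠ 0) (ha : a 0 + a 1 = s) (hb : b 0 + b 1 = m * (a 0 + a 1))
    (hb' : b 0 * b 1 = m * (a 0 * a 1)) (hc : c 0 + c 1 = n * (a 0 + a 1))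
    (hc' : c 0 * c 1 = n * (a 0 * a 1)) : planeDet (b 0) (c 0) ≠ 0 := by
  intro hd
  obtain ⟨v, hv⟩ : ∃ v : ℝ, c 0 = v * b 0 := by
    have hb0 := pow_ne_zero 2 (norm_ne_zero_iff.2 (h.b_ne_zero 0))
    have hb1 := norm_sq_re_im (b 0)
    refine ⟨planeDot (b 0) (c 0) / ‖b 0‖ ^ 2, ?_⟩
    simp only [planeDet] at hd
    apply Complex.ext <;>
    · simp only [planeDot, Complex.mul_re, Complex.mul_im, Complex.ofReal_re, Complex.ofReal_im]
      simp only [zero_mul, sub_zero, add_zero]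
      rw [div_mul_eq_mul_div, eq_div_iff hb0, hb1]
      first | linear_combination -(b 0).im * hd | linear_combination (b 0).re * hd
  have hv1 : v - 1 ≠ 0 := by
    intro e
    have : v = 1 := by linarith
    rw [this, Complex.ofReal_one, one_mul] at hv
    exact h.bc_ne 0 0 hv.symm
  have lin : ((m * v ^ 2 - n : ℝ) : ℂ) * b 0 = (m * n * s * (v - 1) : ℝ) := by
    apply mul_right_cancel₀ (h.b_ne_zero 0)
    push_cast
    rw [hv] at hc hc'
    rw [ha] at hb hc
    linear_combination (m * v * b 0) * hc - m * hc' - n * b 0 * hb + n * hb'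
  have hre := congrArg Complex.re lin
  have him := congrArg Complex.im lin
  simp only [Complex.mul_re, Complex.mul_im, Complex.ofReal_re, Complex.ofReal_im] at hre him
  have hne : m * v ^ 2 - n ≠ 0 := by
    intro e
    rw [e] at hre
    have : m * n * s * (v - 1) = 0 := by linarith
    exact mul_ne_zero (mul_ne_zero (mul_ne_zero hm hn) hs) hv1 this
  -- so all of `b`, `c` and the coefficients of the quadratic equation for `a` are real
  have ib : (b 0).im = 0 := by
    apply (mul_eq_zero.1 _).resolve_left hne
    linarith
  have iS : (a 0 + a 1).im = 0 := by rw [ha, Complex.ofReal_im]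
  have ib1 : (b 1).im = 0 := by
    have := congrArg Complex.im hb
    rw [Complex.add_im, ha, ← Complex.ofReal_mul, Complex.ofReal_im] at this
    linarith
  have ic : (c 0).im = 0 := by
    rw [hv, Complex.mul_im, Complex.ofReal_im, ib]; ring
  have ic1 : (c 1).im = 0 := by
    have := congrArg Complex.im hc
    rw [Complex.add_im, ha, ← Complex.ofReal_mul, Complex.ofReal_im] at this
    linarith
  have iP : (a 0 * a 1).im = 0 := by
    have := congrArg Complex.im hb'
    rw [Complex.mul_im, ib, ib1, Complex.mul_im, Complex.ofReal_im, Complex.ofReal_re] at this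
    apply (mul_eq_zero.1 _).resolve_left hm
    linarith
  rcases real_or_conj iS iP with ⟨h₀, -⟩ | h₁
  · apply h.face_ne_zero 0 0 0
    simp only [planeDet, Complex.sub_im, ib, ic, h₀]; ring
  · exact h.false_of_conj_real h₁ (Fin.forall_fin_two.2 ⟨ic, ic1⟩)

/-- The planar position, in coordinates for which the sum of the first pair of vertices is real. -/
theorem exists_isConcentric (h : IsPlanarPosition a b c T U rC rB) {s : ℝ} (hs : s ≠ 0)
    (ha : a 0 + a 1 = s) :
    ∃ m R : Fin 3 → ℝ, IsConcentric ![a, b, c] m R ∧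
      ¬ (‖a 0‖ = ‖a 1‖ ∧ ‖b 0‖ = ‖b 1‖) ∧ ¬ (‖b 0‖ = ‖b 1‖ ∧ ‖c 0‖ = ‖c 1‖) ∧
      (‖a 0‖ = ‖a 1‖ → ‖c 0‖ = ‖c 1‖ →
        ((∀ j, ‖a 0 - b j‖ = ‖a 1 - b j‖) ∧ (∀ j, ‖c 0 - b j‖ = ‖c 1 - b j‖) ∧
          ‖c 0 - a 0‖ = ‖c 1 - a 1‖ ∧ ‖c 0 - a 1‖ = ‖c 1 - a 0‖) ∧
        0 < 1 - m 0 / m 1 ∧ 0 < 1 - m 2 / m 1 ∧ 0 < m 0 * m 2) := by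
  obtain ⟨m, hm, hb, hb'⟩ := h.exists_ratio_b
  obtain ⟨n, hn, hc, hc'⟩ := h.exists_ratio_c
  have isog : IsIsogonal ![a, b, c] ![1, m, n] := by
    refine ⟨?_, ?_, ?_, ?_⟩
    · intro k i
      fin_cases k
      exacts [h.a_ne_zero i, h.b_ne_zero i, h.c_ne_zero i]
    · intro k
      fin_cases k
      exacts [one_ne_zero, hm, hn]
    · intro k l
      fin_cases k <;> fin_cases l <;> simp [hb, hc] <;> ring
    · intro k l
      fin_cases k <;> fin_cases l <;> simp [hb', hc'] <;> ring
  -- the lines between `b` and `c` have the same distance from the center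
  have mb : ∀ i, planeDet (b i) (c 0) ^ 2 / ‖c 0 - b i‖ ^ 2 =
      planeDet (b i) (c 1) ^ 2 / ‖c 1 - b i‖ ^ 2 := fun i =>
    planeDet_sq_mirror (h.b_ne_zero i)
      (isog.ratio_ne (k := 1) (l := 2) fun i j => (h.bc_ne i j).symm) (isog.mirror 1 2 i)
  have mc : ∀ i, planeDet (c i) (b 0) ^ 2 / ‖b 0 - c i‖ ^ 2 =
      planeDet (c i) (b 1) ^ 2 / ‖b 1 - c i‖ ^ 2 := fun i =>
    planeDet_sq_mirror (h.c_ne_zero i)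
      (isog.ratio_ne (k := 2) (l := 1) fun i j => h.bc_ne j i) (isog.mirror 2 1 i)
  have mbc : ∀ i j, planeDet (b i) (c j) ^ 2 / ‖c j - b i‖ ^ 2 =
      planeDet (b 0) (c 0) ^ 2 / ‖c 0 - b 0‖ ^ 2 := by
    have e : ∀ j, planeDet (b 1) (c j) ^ 2 / ‖c j - b 1‖ ^ 2 =
        planeDet (b 0) (c j) ^ 2 / ‖c j - b 0‖ ^ 2 := by
      intro j
      have := mc j
      rw [planeDet_swap, neg_sq, norm_sub_rev, planeDet_swap (c j) (b 1), neg_sq,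
        norm_sub_rev (b 1)] at this
      exact this.symm
    intro i j
    fin_cases i <;> fin_cases j <;> simp only [Fin.zero_eta, Fin.mk_one]
    · exact (mb 0).symm
    · exact e 0
    · rw [e 1]; exact (mb 0).symm
  have nbc : ∀ i j, 0 < ‖c j - b i‖ := fun i j =>
    norm_pos_iff.2 (sub_ne_zero.2 (h.bc_ne i j).symm)
  have rot : ∀ x y z : ℂ, planeDet (y - x) (z - x) = planeDet (z - y) (x - y) := by
    intro x y z; simp only [planeDet, Complex.sub_re, Complex.sub_im]; ring
  have conc : IsConcentric ![a, b, c] ![1, m, n]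
      ![planeDet (b 0) (c 0) ^ 2 / ‖c 0 - b 0‖ ^ 2, rB ^ 2, rC ^ 2] := by
    refine ⟨isog, ?_, ?_, ?_, ?_⟩
    · intro k
      fin_cases k
      exacts [h.a_ne, h.b_ne, h.c_ne]
    · intro k i j l
      fin_cases k
      · exact h.face_ne_zero i j l
      · have := h.face_ne_zero l i j
        rw [rot] at this; exact this
      · have := h.face_ne_zero j l i
        rw [rot, rot] at this; exact this
    · intro k
      fin_cases k
      · have := h.planeDet_bc_ne_zero hs hm hn ha hb hb' hc hc'
        have := nbc 0 0
        show 0 < planeDet (b 0) (c 0) ^ 2 / ‖c 0 - b 0‖ ^ 2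
        positivity
      · exact pow_pos h.rB_pos 2
      · exact pow_pos h.rC_pos 2
    · intro k i j
      fin_cases k
      · show planeDet (b i) (c j) ^ 2 =
          planeDet (b 0) (c 0) ^ 2 / ‖c 0 - b 0‖ ^ 2 * ‖c j - b i‖ ^ 2
        rw [← mbc i j, div_mul_cancel₀ _ (pow_pos (nbc i j) 2).ne']
      · show planeDet (c i) (a j) ^ 2 = rB ^ 2 * ‖a j - c i‖ ^ 2
        rw [planeDet_swap, neg_sq, norm_sub_rev]
        exact h.touch_ac j i
      · exact h.touch_ab i j
  have iS : (a 0 + a 1).im = 0 := by rw [ha, Complex.ofReal_im]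
  have hb₁ : b 0 + b 1 = (m * s : ℝ) := by rw [hb, ha]; push_cast; rfl
  have hc₁ : c 0 + c 1 = (n * s : ℝ) := by rw [hc, ha]; push_cast; rfl
  have ab : ¬ (‖a 0‖ = ‖a 1‖ ∧ ‖b 0‖ = ‖b 1‖) := fun ⟨ea, eb⟩ =>
    h.false_of_conj_ab hs ha hb hb' (conj_of_norm_eq hs ha ea)
      (conj_of_norm_eq (mul_ne_zero hm hs) hb₁ eb)
  refine ⟨![1, m, n], _, conc, ab, ?_, ?_⟩
  · rintro ⟨eb, ec⟩
    have cb := conj_of_norm_eq (mul_ne_zero hm hs) hb₁ eb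
    have cc := conj_of_norm_eq (mul_ne_zero hn hs) hc₁ ec
    have iP : (a 0 * a 1).im = 0 := by
      have := im_mul_of_conj cb
      rw [hb', Complex.im_ofReal_mul] at this
      exact (mul_eq_zero.1 this).resolve_left hm
    rcases real_or_conj iS iP with ⟨h₀, h₁⟩ | h₁
    · exact h.false_of_real_conj (Fin.forall_fin_two.2 ⟨h₀, h₁⟩) cc
    · exact ab ⟨by rw [h₁, Complex.norm_conj], eb⟩
  · intro ea ec
    have ca := conj_of_norm_eq hs ha ea
    have cc := conj_of_norm_eq (mul_ne_zero hn hs) hc₁ ec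
    have iP := im_mul_of_conj ca
    have ib : ∀ j, (b j).im = 0 := by
      have iS' : (b 0 + b 1).im = 0 := by rw [hb₁, Complex.ofReal_im]
      have iP' : (b 0 * b 1).im = 0 := by rw [hb', Complex.im_ofReal_mul, iP, mul_zero]
      rcases real_or_conj iS' iP' with h₀ | h₁
      · exact Fin.forall_fin_two.2 h₀
      · exact (ab ⟨ea, by rw [h₁, Complex.norm_conj]⟩).elim
    have ratio : ∀ {x : Fin 2 → ℂ} {l : ℝ}, x 1 = conj (x 0) → x 0 ≠ b 0 →
        (x 0 - b 0) * (x 1 - b 0) = (l : ℂ) * b 0 ^ 2 → 0 < l := by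
      intro x l hx hne hl
      have e : x 1 - b 0 = conj (x 0 - b 0) := by
        rw [map_sub, hx, Complex.conj_eq_iff_im.2 (ib 0)]
      have hbr : b 0 = ((b 0).re : ℝ) := by
        apply Complex.ext <;> simp [ib 0]
      rw [e, Complex.mul_conj, Complex.normSq_eq_norm_sq, hbr] at hl
      have hl' : ‖x 0 - ((b 0).re : ℝ)‖ ^ 2 = l * (b 0).re ^ 2 := by exact_mod_cast hl
      rw [← hbr] at hl'
      have hp : 0 < l * (b 0).re ^ 2 := by
        rw [← hl']; have := norm_pos_iff.2 (sub_ne_zero.2 hne); positivity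
      exact pos_of_mul_pos_left hp (sq_nonneg _)
    refine ⟨⟨fun j => norm_sub_of_conj ca (ib j), fun j => norm_sub_of_conj cc (ib j), ?_, ?_⟩,
      ratio ca (h.ab_ne 0 0) (isog.mirror 1 0 0), ratio cc (h.bc_ne 0 0).symm (isog.mirror 1 2 0),
      ?_⟩
    · rw [ca, cc, ← map_sub, Complex.norm_conj]
    · rw [ca, cc, ← Complex.norm_conj, map_sub, Complex.conj_conj]
    · show 0 < 1 * n
      rw [one_mul]
      rw [ca, cc, Complex.mul_conj, Complex.mul_conj, Complex.normSq_eq_norm_sq,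
        Complex.normSq_eq_norm_sq] at hc'
      have hc'' : ‖c 0‖ ^ 2 = n * ‖a 0‖ ^ 2 := by exact_mod_cast hc'
      have hp : 0 < n * ‖a 0‖ ^ 2 := by
        rw [← hc'']; have := norm_pos_iff.2 (h.c_ne_zero 0); positivity
      exact pos_of_mul_pos_left hp (sq_nonneg _)

end IsPlanarPosition

end Bricard

theorem theorem7 (O : Bricard.Octahedron Bricard.E2) (hO : Bricard.IsFlatType3 O)
    (I : Set ℝ) (hI : I.OrdConnected)
    (P : ℝ → Bricard.Octahedron Bricard.E3) (hP : Bricard.IsFlex O I P)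
    (ω : ℤˣ) (α : Fin 3 → Fin 2 → Fin 2 → ℝ → ℝ)
    (hα_cont : ∀ k i j, ContinuousOn (α k i j) I)
    (hα : ∀ t ∈ I, ∀ k i j, Bricard.IsDihedralAngle ω (P t) k i j (α k i j t))
    (f : ℝ →ₗ[ℚ] ℝ) (hf : f Real.pi = 0) :
    (∀ t₁ ∈ I, ∀ t₂ ∈ I,
      Bricard.dehnInvariant f (P t₁) (fun k i j => α k i j t₁) =
        Bricard.dehnInvariant f (P t₂) (fun k i j => α k i j t₂)) ∧
    ∀ t ∈ I, Bricard.dehnInvariant f (P t) (fun k i j => α k i j t) = 0 := by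
  have key : ∀ t ∈ I, Bricard.dehnInvariant f (P t) (fun k i j => α k i j t) = 0 := by
    intro t ht
    obtain ⟨o, rB, rC, hpos⟩ := hO.exists_planarPosition
    -- rotate the coordinates so that the sum of the first two vertices becomes real
    let Φ₀ : Bricard.E2 ≃ₗᵢ[ℝ] ℂ := Complex.orthonormalBasisOneI.repr.symm
    obtain ⟨T₀, U₀, h₀⟩ := hpos Φ₀
    have hS := h₀.a_add_ne_zero
    set S := Φ₀ (O 0 0 - o) + Φ₀ (O 0 1 - o) with hSdef
    have hSn : ‖S‖ ≠ 0 := norm_ne_zero_iff.2 hS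
    let u : Circle := Circle.exp (-S.arg)
    have hu : (u : ℂ) * S = (‖S‖ : ℝ) := by
      rw [Circle.coe_exp]
      conv_lhs => rw [← Complex.norm_mul_exp_arg_mul_I S, mul_left_comm, ← Complex.exp_add]
      simp
    let Φ : Bricard.E2 ≃ₗᵢ[ℝ] ℂ := Φ₀.trans (rotation u)
    obtain ⟨T, U, h⟩ := hpos Φ
    have hsum : Φ (O 0 0 - o) + Φ (O 0 1 - o) = (‖S‖ : ℝ) := by
      rw [← hu, hSdef, mul_add]; rfl
    obtain ⟨m, R, hz, h₀₁, h₁₂, hsym⟩ := h.exists_isConcentric hSn hsum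
    refine hz.dehnInvariant_eq_zero h₀₁ h₁₂ hsym ?_ (hα t ht) hf
    intro k l i j hkl
    have hc := hP.congruent t ht (fun n => if n = k then i else j) k l
    simp only [Bricard.face, if_true, if_neg hkl.symm] at hc
    rw [edist_dist, edist_dist, ENNReal.ofReal_eq_ofReal_iff dist_nonneg dist_nonneg] at hc
    have hzk : ∀ k i, (![fun i => Φ (O 0 i - o), fun i => Φ (O 1 i - o),
        fun i => Φ (O 2 i - o)] : Fin 3 → Fin 2 → ℂ) k i = Φ (O k i - o) := by
      intro k i; fin_cases k <;> rfl
    rw [hc, hzk, hzk, ← map_sub, Φ.norm_map, sub_sub_sub_cancel_right, dist_eq_norm]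
  exact ⟨fun t₁ h₁ t₂ h₂ => (key t₁ h₁).trans (key t₂ h₂).symm, key⟩
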